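/- Let $k$ be an algebraically closed field of characteristic $p>0$, let $W_2(k)$ be the ring of Witt vectors of length $2$ over $k$ with its Witt vector Frobenius $\sigma$, and let $X$ be a smooth variety over $k$ (an integral, separated, quasi-compact scheme, smooth over $k$) with absolute Frobenius $F_X$. Let $(\tilde X,\tilde F)$ be a $W_2(k)$-lifting of the Frobenius of $X$: a flat $W_2(k)$-scheme $\tilde X$ with an identification $\tilde X\times_{W_2(k)}k\cong X$, giving a closed immersion $i:X\to\tilde X$, and a morphism of schemes $\tilde F:\tilde X\to\tilde X$ with $\tilde F\circ i=i\circ F_X$. Then $\tilde F$ lies over $\operatorname{Spec}\sigma$, so that it has a differential $d\tilde F:\tilde F^*\Omega^1_{\tilde X/W_2(k)}\to\Omega^1_{\tilde X/W_2(k)}$. Multiplication by $p$ on $\Omega^1_{\tilde X/W_2(k)}$ factors uniquely through the reduction map $\Omega^1_{\tilde X/W_2(k)}\to i_*\Omega^1_{X/k}$, $\omega\mapsto\bar\omega$, and the resulting $\mathcal O_{\tilde X}$-linear map $\mathbf p:i_*\Omega^1_{X/k}\to\Omega^1_{\tilde X/W_2(k)}$, $\mathbf p(\bar\omega)=p\,\omega$,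 is injective. There is a unique $\mathcal O_X$-linear morphism $$\varphi_{\tilde F}:F_X^*\Omega^1_{X/k}\longrightarrow\Omega^1_{X/k}$$ ("$d\tilde F$ divided by $p$") such that $d\tilde F(\tilde F^*\omega)=\mathbf p\bigl(\varphi_{\tilde F}(F_X^*\bar\omega)\bigr)$ for all local sections $\omega$ of $\Omega^1_{\tilde X/W_2(k)}$, and $\varphi_{\tilde F}$ is generically bijective: it restricts to an isomorphism over a dense open subset of $X$. -/

import Mathlib

open CategoryTheory Opposite TopologicalSpace AlgebraicGeometry

universe u

noncomputable section

namespace FrobLift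

/-! ### The absolute Frobenius of a scheme of characteristic `p` -/

/-- The `p`-power ring endomorphism of a commutative ring in which `p = 0`
(the zero ring, i.e. sections over the empty set, is allowed). -/
def powHom (p : ℕ) [hp : Fact p.Prime] (R : Type u) [CommRing R] (h : (p : R) = 0) : R →+* R where
  toFun a := a ^ p
  map_one' := one_pow p
  map_mul' a b := mul_pow a b p
  map_zero' := zero_pow hp.out.ne_zero
  map_add' a b := by
    obtain ⟨r, hr⟩ := exists_add_pow_prime_eq hp.out a b
    rw [hr, h]; ring

theorem natCast_section_eq_zero {p : ℕ} (X : Scheme.{u}) (h : (p : Γ(X, ⊤)) = 0) (U : X.Opens) :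
    (p : Γ(X, U)) = 0 := by
  have := congrArg (X.presheaf.map (homOfLE (le_top : U ≤ ⊤)).op).hom h
  simpa using this

/-- The absolute Frobenius as a morphism of ringed spaces. -/
def absFrobeniusHom (p : ℕ) [Fact p.Prime] (X : Scheme.{u}) (h : (p : Γ(X, ⊤)) = 0) :
    X.toPresheafedSpace.Hom X.toPresheafedSpace where
  base := 𝟙 _
  c :=
    { app := fun U => CommRingCat.ofHom
        (powHom p Γ(X, U.unop) (natCast_section_eq_zero X h U.unop))
      naturality := fun U V i => by
        ext a
        exact (map_pow (X.presheaf.map i).hom a p).symm }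

/-- The absolute Frobenius `F_X : X ⟶ X` of a scheme on which `p = 0`: the identity on points and
`a ↦ a ^ p` on sections. -/
def absFrobenius (p : ℕ) [Fact p.Prime] (X : Scheme.{u}) (h : (p : Γ(X, ⊤)) = 0) : X ⟶ X where
  toLRSHom' :=
    { __ := absFrobeniusHom p X h
      prop := fun x => by
        constructor
        intro a ha
        obtain ⟨U, hx, s, rfl⟩ := X.presheaf.exists_germ_eq a
        have key := PresheafedSpace.stalkMap_germ_apply (absFrobeniusHom p X h) U x hx s
        have key2 : (X.presheaf.germ ((Opens.map (absFrobeniusHom p X h).base).obj U) x hx).hom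
            (((absFrobeniusHom p X h).c.app (op U)).hom s) = (X.presheaf.germ U x hx).hom s ^ p :=
          map_pow (X.presheaf.germ U x hx).hom s p
        have := key.trans key2
        exact (isUnit_pow_iff (Fact.out : p.Prime).ne_zero).1 (Eq.mp (congrArg IsUnit this) ha) }

/-! ### The truncated Witt ring `W₂(k)` -/

/-- The reduction `W₂(k) → k`, `(x₀, x₁) ↦ x₀`. -/
def residueMap (p : ℕ) [Fact p.Prime] (k : Type u) [CommRing k] :
    TruncatedWittVector p 2 k →+* k where
  toFun x := x.coeff 0
  map_one' := by
    rw [← map_one (WittVector.truncate 2 : WittVector p k →+* _), WittVector.coeff_truncate]; simp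
  map_zero' := by simp
  map_add' x y := by
    obtain ⟨x, rfl⟩ := WittVector.truncate_surjective p 2 k x
    obtain ⟨y, rfl⟩ := WittVector.truncate_surjective p 2 k y
    rw [← map_add]; simp only [WittVector.coeff_truncate]; simp [WittVector.add_coeff_zero]
  map_mul' x y := by
    obtain ⟨x, rfl⟩ := WittVector.truncate_surjective p 2 k x
    obtain ⟨y, rfl⟩ := WittVector.truncate_surjective p 2 k y
    rw [← map_mul]; simp only [WittVector.coeff_truncate]; simp [WittVector.mul_coeff_zero]

theorem mk_coeff_pow_truncate (p : ℕ) [Fact p.Prime] (k : Type u) [CommRing k] [CharP k p]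
    (x : WittVector p k) :
    (TruncatedWittVector.mk p fun j => (WittVector.truncate 2 x).coeff j ^ p) =
      WittVector.truncate 2 (WittVector.frobenius x) := by
  ext j; simp [WittVector.coeff_frobenius_charP]

/-- The Witt vector Frobenius `σ` of `W₂(k)`, `(x₀, x₁) ↦ (x₀ ^ p, x₁ ^ p)`. -/
def wittFrobenius (p : ℕ) [Fact p.Prime] (k : Type u) [CommRing k] [CharP k p] :
    TruncatedWittVector p 2 k →+* TruncatedWittVector p 2 k where
  toFun x := TruncatedWittVector.mk p fun j => x.coeff j ^ p
  map_one' := by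
    rw [← map_one (WittVector.truncate 2 : WittVector p k →+* _), mk_coeff_pow_truncate]; simp
  map_zero' := by
    rw [← map_zero (WittVector.truncate 2 : WittVector p k →+* _), mk_coeff_pow_truncate]; simp
  map_add' x y := by
    obtain ⟨x, rfl⟩ := WittVector.truncate_surjective p 2 k x
    obtain ⟨y, rfl⟩ := WittVector.truncate_surjective p 2 k y
    simp only [← map_add (WittVector.truncate 2 : WittVector p k →+* _), mk_coeff_pow_truncate]
    rw [map_add]
  map_mul' x y := by
    obtain ⟨x, rfl⟩ := WittVector.truncate_surjective p 2 k x
    obtain ⟨y, rfl⟩ := WittVector.truncate_surjective p 2 k y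
    simp only [← map_mul (WittVector.truncate 2 : WittVector p k →+* _), mk_coeff_pow_truncate]
    rw [map_mul]

/-! ### The sheaf of relative differentials of a scheme over an affine base -/

section Differentials

variable {R R' : CommRingCat.{u}} {X Y : Scheme.{u}}

/-- For `f : X ⟶ Spec R`, the structure maps `R ⟶ Γ(X, U)`, as a morphism from a constant
presheaf of rings. -/
def constToStructure (f : X ⟶ Spec R) : (Functor.const _).obj R ⟶ X.presheaf where
  app U := (Scheme.ΓSpecIso R).inv ≫ f.appTop ≫ X.presheaf.map (homOfLE (le_top : U.unop ≤ ⊤)).op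
  naturality U V i := by
    simp only [Functor.const_obj_obj, Functor.const_obj_map, Category.id_comp, Category.assoc,
      ← Functor.map_comp]
    rfl

/-- The presheaf of `𝒪_X`-modules `U ↦ Ω¹` of the `R`-algebra `Γ(X, U)`. -/
def presheafDifferentials (f : X ⟶ Spec R) : X.PresheafOfModules :=
  PresheafOfModules.DifferentialsConstruction.relativeDifferentials' (constToStructure f)

/-- The sheaf of relative differentials `Ω¹_{X/R}`: the `𝒪_X`-module associated to the presheaf
`U ↦ Ω¹_{Γ(X, U)/R}`. -/
def sheafDifferentials (f : X ⟶ Spec R) : X.Modules :=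
  (PresheafOfModules.sheafification (𝟙 X.ringCatSheaf.obj)).obj (presheafDifferentials f)

def toSheafDifferentials (f : X ⟶ Spec R) :
    presheafDifferentials f ⟶
      (Scheme.Modules.toPresheafOfModules X).obj (sheafDifferentials f) :=
  PresheafOfModules.sheafificationHomEquiv (𝟙 X.ringCatSheaf.obj) (𝟙 _)

/-- The universal derivation `d : 𝒪_X → Ω¹_{X/R}` on sections over `U`. -/
def d (f : X ⟶ Spec R) (U : X.Opens) : Γ(X, U) →+ Γ(sheafDifferentials f, U) :=
  AddMonoidHom.mk' (fun a => ((toSheafDifferentials f).app (op U)).hom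
      (CommRingCat.KaehlerDifferential.d (f := (constToStructure f).app (op U)) a))
    (fun a b => (congrArg ((toSheafDifferentials f).app (op U)).hom
      (ModuleCat.Derivation.d_add
        (CommRingCat.KaehlerDifferential.D ((constToStructure f).app (op U))) a b)).trans
      (map_add _ _ _))

theorem d_mul (f : X ⟶ Spec R) (U : X.Opens) (a b : Γ(X, U)) :
    d f U (a * b) = a • d f U b + b • d f U a := by
  refine (congrArg ((toSheafDifferentials f).app (op U)).hom (ModuleCat.Derivation.d_mul
    (CommRingCat.KaehlerDifferential.D ((constToStructure f).app (op U))) a b)).trans ?_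
  refine (map_add _ _ _).trans ?_
  exact congrArg₂ (· + ·) (LinearMap.map_smul _ _ _) (LinearMap.map_smul _ _ _)

theorem d_res (f : X ⟶ Spec R) {U V : X.Opens} (i : V ⟶ U) (a : Γ(X, U)) :
    (sheafDifferentials f).presheaf.map i.op (d f U a) = d f V (X.presheaf.map i.op a) := by
  refine (PresheafOfModules.naturality_apply (toSheafDifferentials f) i.op _).symm.trans ?_
  exact congrArg ((toSheafDifferentials f).app (op V)).hom
    (PresheafOfModules.DifferentialsConstruction.relativeDifferentials'_map_d
      (constToStructure f) i.op a)

theorem d_const (f : X ⟶ Spec R) (U : X.Opens) (r : R) :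
    d f U ((constToStructure f).app (op U) r) = 0 :=
  (congrArg ((toSheafDifferentials f).app (op U)).hom (ModuleCat.Derivation.d_map
    (CommRingCat.KaehlerDifferential.D ((constToStructure f).app (op U))) r)).trans (map_zero _)

theorem constToStructure_comp (f : X ⟶ Spec R') (h : Y ⟶ Spec R) (g : X ⟶ Y)
    (σ : R ⟶ R') (w : g ≫ h = f ≫ Spec.map σ) (U : Y.Opens) :
    (constToStructure h).app (op U) ≫ g.app U =
      σ ≫ (constToStructure f).app (op (g ⁻¹ᵁ U)) := by
  have h1 : h.appTop ≫ g.appTop = (Spec.map σ).appTop ≫ f.appTop := by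
    rw [← Scheme.Hom.comp_appTop, ← Scheme.Hom.comp_appTop, w]
  have h2 : (Scheme.ΓSpecIso R).inv ≫ (Spec.map σ).appTop = σ ≫ (Scheme.ΓSpecIso R').inv :=
    (Scheme.ΓSpecIso_inv_naturality σ).symm
  have h3 : Y.presheaf.map (homOfLE (le_top : U ≤ ⊤)).op ≫ g.app U =
      g.appTop ≫ X.presheaf.map (homOfLE (le_top : g ⁻¹ᵁ U ≤ ⊤)).op :=
    g.naturality _
  simp only [constToStructure, Category.assoc]
  rw [h3, reassoc_of% h1, reassoc_of% h2]

/-- For a commutative square `g` over `Spec σ`, the derivation `a ↦ d (g^♯ a)` of `𝒪_Y` with values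
in `g_* Ω¹_{X/R'}`. -/
def pushforwardDerivation (f : X ⟶ Spec R') (h : Y ⟶ Spec R) (g : X ⟶ Y)
    (σ : R ⟶ R') (w : g ≫ h = f ≫ Spec.map σ) :
    PresheafOfModules.Derivation' ((Scheme.Modules.toPresheafOfModules Y).obj
      ((Scheme.Modules.pushforward g).obj (sheafDifferentials f))) (constToStructure h) where
  d {U} := (d f (g ⁻¹ᵁ U.unop)).comp (g.app U.unop).hom.toAddMonoidHom
  d_mul {U} a b :=
    (congrArg (d f (g ⁻¹ᵁ U.unop)) (map_mul (g.app U.unop).hom a b)).trans (d_mul f _ _ _)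
  d_map {U V} i a :=
    (congrArg (d f (g ⁻¹ᵁ V.unop)) (ConcreteCategory.congr_hom (g.c.naturality i) a)).trans
      (d_res f ((Opens.map g.base).map i.unop) (g.app U.unop a)).symm
  d_app {U} a :=
    (congrArg (d f (g ⁻¹ᵁ U.unop)) (ConcreteCategory.congr_hom
      (constToStructure_comp f h g σ w U.unop) a)).trans (d_const f _ (σ a))

/-- The differential of a morphism `g : X ⟶ Y` lying over `Spec σ : Spec R' ⟶ Spec R`, in its
adjoint form `Ω¹_{Y/R} ⟶ g_* Ω¹_{X/R'}`, `d a ↦ d (g^♯ a)`. -/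
def differential (f : X ⟶ Spec R') (h : Y ⟶ Spec R) (g : X ⟶ Y)
    (σ : R ⟶ R') (w : g ≫ h = f ≫ Spec.map σ) :
    sheafDifferentials h ⟶ (Scheme.Modules.pushforward g).obj (sheafDifferentials f) :=
  (PresheafOfModules.sheafificationHomEquiv (𝟙 Y.ringCatSheaf.obj)).symm
    ((PresheafOfModules.DifferentialsConstruction.isUniversal' (constToStructure h)).desc
      (pushforwardDerivation f h g σ w))

/-- The formula characterizing the differential of `g`. -/
theorem differential_d (f : X ⟶ Spec R') (h : Y ⟶ Spec R) (g : X ⟶ Y)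
    (σ : R ⟶ R') (w : g ≫ h = f ≫ Spec.map σ) (U : Y.Opens) (a : Γ(Y, U)) :
    (differential f h g σ w).app U (d h U a) = d f (g ⁻¹ᵁ U) (g.app U a) := by
  have h1 : toSheafDifferentials h ≫
      (Scheme.Modules.toPresheafOfModules Y).map (differential f h g σ w) =
      (PresheafOfModules.DifferentialsConstruction.isUniversal' (constToStructure h)).desc
        (pushforwardDerivation f h g σ w) := by
    have h3 := (PresheafOfModules.sheafificationAdjunction
      (𝟙 Y.ringCatSheaf.obj)).homEquiv_naturality_right (𝟙 _) (differential f h g σ w)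
    refine h3.symm.trans ?_
    refine (congrArg ((PresheafOfModules.sheafificationAdjunction
      (𝟙 Y.ringCatSheaf.obj)).homEquiv _ _)
      (Category.id_comp (differential f h g σ w))).trans ?_
    exact Equiv.apply_symm_apply (PresheafOfModules.sheafificationHomEquiv
      (𝟙 Y.ringCatSheaf.obj)) _
  have h2 := PresheafOfModules.Derivation.congr_d
    ((PresheafOfModules.DifferentialsConstruction.isUniversal' (constToStructure h)).fac
      (pushforwardDerivation f h g σ w)) (X := op U) a
  rw [← h1] at h2
  exact h2

end Differentials

/-- A morphism of `𝒪_X`-modules is generically bijective if it restricts to an isomorphism over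
some dense open subscheme. -/
def GenericallyBijective {X : Scheme.{u}} {M N : X.Modules} (φ : M ⟶ N) : Prop :=
  ∃ U : X.Opens, Dense (U : Set X) ∧ IsIso ((Scheme.Modules.restrictFunctor U.ι).map φ)

/-! ### Liftings of Frobenius to `W₂(k)` -/

section Lift

theorem natCast_top_eq_zero (p : ℕ) {k : Type u} [CommRing k] [CharP k p] {X : Scheme.{u}}
    (f : X ⟶ Spec (.of k)) : (p : Γ(X, ⊤)) = 0 := by
  let g : k →+* Γ(X, ⊤) := ((constToStructure f).app (op ⊤)).hom
  rw [← map_natCast g, CharP.cast_eq_zero, map_zero]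

variable (p : ℕ) [Fact p.Prime] {k : Type u} [CommRing k] [CharP k p] {X : Scheme.{u}}

/-- The absolute Frobenius of a scheme over a ring `k` of characteristic `p`. -/
def schemeFrobenius (f : X ⟶ Spec (.of k)) : X ⟶ X :=
  absFrobenius p X (natCast_top_eq_zero p f)

/-- A `W₂(k)`-lifting of the Frobenius of a `k`-scheme `X`: a flat `W₂(k)`-scheme `total` with an
identification of `X` with its base change to `k`, and an endomorphism `F` of `total`
restricting to the absolute Frobenius of `X`. -/
structure FrobeniusLifting (f : X ⟶ Spec (.of k)) where
  total : Scheme.{u}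
  str : total ⟶ Spec (.of (TruncatedWittVector p 2 k))
  flat : Flat str
  incl : X ⟶ total
  isPullback : IsPullback incl f str (Spec.map (CommRingCat.ofHom (residueMap p k)))
  F : total ⟶ total
  comm : incl ≫ F = schemeFrobenius p f ≫ incl

namespace FrobeniusLifting

variable {p} {f : X ⟶ Spec (.of k)} (L : FrobeniusLifting p f)

open Scheme.Modules

/-- `F` lies over the Witt vector Frobenius of `W₂(k)`. -/
def IsSemilinear : Prop :=
  L.F ≫ L.str = L.str ≫ Spec.map (CommRingCat.ofHom (wittFrobenius p k))

/-- The reduction map `Ω¹_{𝐗/W₂(k)} ⟶ i_* Ω¹_{X/k}`, where `i : X ⟶ 𝐗` is the inclusion. -/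
def reduction :
    sheafDifferentials L.str ⟶ (pushforward L.incl).obj (sheafDifferentials f) :=
  differential f L.str L.incl _ L.isPullback.w

/-- The differential of `F`, in the adjoint form `Ω¹_{𝐗/W₂(k)} ⟶ F_* Ω¹_{𝐗/W₂(k)}`. -/
def dF (h : L.IsSemilinear) :
    sheafDifferentials L.str ⟶ (pushforward L.F).obj (sheafDifferentials L.str) :=
  differential L.str L.str L.F _ h

/-- `P : i_* Ω¹_{X/k} ⟶ Ω¹_{𝐗/W₂(k)}` is the map induced by multiplication by `p`, i.e.
`P (ω mod p) = p ω`. -/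
def IsMulP (P : (pushforward L.incl).obj (sheafDifferentials f) ⟶ sheafDifferentials L.str) :
    Prop :=
  L.reduction ≫ P = p • 𝟙 (sheafDifferentials L.str)

/-- The canonical identification `i_* F_{X*} M ≅ F_* i_* M` coming from `F ∘ i = i ∘ F_X`. -/
def pushforwardSquare (M : X.Modules) :
    (pushforward L.incl).obj ((pushforward (schemeFrobenius p f)).obj M) ≅
      (pushforward L.F).obj ((pushforward L.incl).obj M) :=
  (pushforwardComp (schemeFrobenius p f) L.incl).app M ≪≫ (pushforwardCongr L.comm.symm).app M ≪≫
    ((pushforwardComp L.incl L.F).app M).symm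

/-- `φ : F_X^* Ω¹_{X/k} ⟶ Ω¹_{X/k}` is the quotient of `dF` by `p`, where `P` is the map induced by
multiplication by `p`: one has `dF (F^* ω) = P (φ (F_X^* (ω mod p)))` for all local sections `ω` of
`Ω¹_{𝐗/W₂(k)}`. -/
def IsDivided (h : L.IsSemilinear)
    (P : (pushforward L.incl).obj (sheafDifferentials f) ⟶ sheafDifferentials L.str)
    (φ : (pullback (schemeFrobenius p f)).obj (sheafDifferentials f) ⟶ sheafDifferentials f) : Prop :=
  L.dF h =
    L.reduction ≫
      (pushforward L.incl).map
        ((pullbackPushforwardAdjunction (schemeFrobenius p f)).homEquiv _ _ φ) ≫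
      (L.pushforwardSquare (sheafDifferentials f)).hom ≫ (pushforward L.F).map P

end FrobeniusLifting

end Lift

end FrobLift

end

noncomputable section

set_option linter.unusedSectionVars false

namespace FrobLift

/-! ### Local equality and construction of morphisms for sheaves of modules. -/

section Modules
open Scheme.Modules
variable {X : Scheme.{u}} {M N : X.Modules}

/-! Locally let `A` be the ring of an affine open of the lift and `B` the corresponding ring of `X`.
The cartesian square gives `B = A / pA` with `p² = 0`, so the inclusion and the lift `F` are
homeomorphisms, `F` being the identity on points.

Existence and uniqueness of the quotient. In the conormal sequence `dp = 0`, so the kernel of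
`Ω[A/W₂] → Ω[B/k]` is `pΩ[A/W₂]`, which `p` kills; multiplication by `p` thus descends to `P`. A
flat lift of a smooth algebra is formally smooth, so `Ω[A/W₂]` is flat over `W₂(k)` and its
`p`-torsion is exactly `pΩ[A/W₂]`; this is injectivity of `P`. As `F a = a ^ p + p b`, one has `dF
(da) = p (a ^ (p - 1) da + db)`, so `dF` factors through `P`. The factor kills `pΩ[A/W₂]` and
descends to `φ`, with `φ (F^* dx) = x ^ (p - 1) dx + dδ` (`IsMulP.exists_isDivided_d`).

Semilinearity. Two maps from `W₂(k)` to functions on the lift that agree on `X` differ by elements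
that square to zero and are killed by `p`. They agree on `p`-th powers and on multiples of `p`, and
every element of `W₂(k)` is `t ^ p + p y` because `k` is perfect (`ringHom_truncated_ext`).

Generic bijectivity. On a nonempty open with coordinates `x i` and partial derivatives `D j`, the
matrix of `φ` has entries `x i ^ (p - 1)` on the diagonal plus `D j (δ i)`. Let `T` be the product
of all `(D j) ^ (p - 1)`. It kills every derivative because `(D j) ^ p = 0`. Removing the exact part
of one row changes the determinant by a divergence, the rows being closed forms; hence `T` takes the
same value on the determinant as on `∏ x i ^ (p - 1)`, namely a power of `(p - 1)!`, which is
nonzero in characteristic `p` (`det_diagonal_add_jacobian_ne_zero`). This is the top-degree shadow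
of the fact that the Cartier operator inverts `φ`. The map is an isomorphism where the determinant
is invertible. -/

theorem section_eq_of_locally_eq {U : X.Opens} (s t : Γ(M, U))
    (h : ∀ x ∈ U, ∃ (V : X.Opens) (_ : x ∈ V) (i : V ⟶ U),
      M.presheaf.map i.op s = M.presheaf.map i.op t) : s = t := by
  choose V hxV i hi using h
  refine TopCat.Sheaf.eq_of_locally_eq' ⟨M.presheaf, M.isSheaf⟩ (fun x : U => V x.1 x.2) U
    (fun x => i x.1 x.2) ?_ s t (fun x => hi x.1 x.2)
  intro x hx
  exact Opens.mem_iSup.2 ⟨⟨x, hx⟩, hxV x hx⟩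

theorem structure_section_eq_of_locally_eq {U : X.Opens} (s t : Γ(X, U))
    (h : ∀ x ∈ U, ∃ (V : X.Opens) (_ : x ∈ V) (i : V ⟶ U),
      X.presheaf.map i.op s = X.presheaf.map i.op t) : s = t := by
  choose V hxV i hi using h
  refine TopCat.Sheaf.eq_of_locally_eq' X.sheaf (fun x : U => V x.1 x.2) U
    (fun x => i x.1 x.2) ?_ s t (fun x => hi x.1 x.2)
  intro x hx
  exact Opens.mem_iSup.2 ⟨⟨x, hx⟩, hxV x hx⟩

theorem app_res (φ : M ⟶ N) {U V : X.Opens} (i : V ⟶ U) (s : Γ(M, U)) :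
    φ.app V (M.presheaf.map i.op s) = N.presheaf.map i.op (φ.app U s) :=
  ConcreteCategory.congr_hom (φ.mapPresheaf.naturality i.op) s

/-- A morphism of `𝒪_X`-modules from compatible linear maps on sections. -/
def modulesHomMk (φ : ∀ U : X.Opens, Γ(M, U) →+ Γ(N, U))
    (hlin : ∀ U (r : Γ(X, U)) (s : Γ(M, U)), φ U (r • s) = r • φ U s)
    (hres : ∀ {U V : X.Opens} (i : V ⟶ U) (s : Γ(M, U)),
      φ V (M.presheaf.map i.op s) = N.presheaf.map i.op (φ U s)) : M ⟶ N where
  val := PresheafOfModules.homMk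
    { app := fun U => AddCommGrpCat.ofHom (φ U.unop)
      naturality := fun U V i => by
        ext s
        exact hres i.unop s }
    (fun U r s => hlin U.unop r s)

theorem modules_hom_ext (φ ψ : M ⟶ N) (h : ∀ U (s : Γ(M, U)), φ.app U s = ψ.app U s) : φ = ψ :=
  Scheme.Modules.hom_ext _ _ fun U => by ext s; exact h U s

end Modules

/-! ### Sections of the sheaf of differentials versus Kähler differentials of section rings. -/

section Differentials

variable {R : CommRingCat.{u}} {X : Scheme.{u}} (f : X ⟶ Spec R)

open Scheme.Modules

/-- The differentials of the ring of sections over `U`. -/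
abbrev sectionDifferentials (U : X.Opens) : ModuleCat Γ(X, U) :=
  CommRingCat.KaehlerDifferential ((constToStructure f).app (op U))

/-- The map from the differentials of the sections over `U` to the sections of the differentials. -/
def toSections (U : X.Opens) : sectionDifferentials f U →+ Γ(sheafDifferentials f, U) :=
  ((toSheafDifferentials f).app (op U)).hom.toAddMonoidHom

/-- The universal derivation of the ring of sections over `U`. -/
def dSec (U : X.Opens) (a : Γ(X, U)) : sectionDifferentials f U :=
  CommRingCat.KaehlerDifferential.d (f := (constToStructure f).app (op U)) a

/-- The restriction maps of the presheaf of differentials. -/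
def resSec {U V : X.Opens} (i : V ⟶ U) : sectionDifferentials f U →+ sectionDifferentials f V :=
  ((presheafDifferentials f).map i.op).hom.toAddMonoidHom

theorem toSections_smul (U : X.Opens) (a : Γ(X, U)) (t : sectionDifferentials f U) :
    toSections f U (a • t) = a • toSections f U t :=
  ((toSheafDifferentials f).app (op U)).hom.map_smul a t

theorem toSections_d (U : X.Opens) (a : Γ(X, U)) :
    toSections f U (dSec f U a) = d f U a := rfl

theorem toSections_res {U V : X.Opens} (i : V ⟶ U) (t : sectionDifferentials f U) :
    toSections f V (resSec f i t) = (sheafDifferentials f).presheaf.map i.op (toSections f U t) :=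
  PresheafOfModules.naturality_apply (toSheafDifferentials f) i.op t

theorem resSec_smul {U V : X.Opens} (i : V ⟶ U) (a : Γ(X, U)) (t : sectionDifferentials f U) :
    resSec f i (a • t) = X.presheaf.map i.op a • resSec f i t :=
  (presheafDifferentials f).map_smul i.op a t

theorem resSec_d {U V : X.Opens} (i : V ⟶ U) (a : Γ(X, U)) :
    resSec f i (dSec f U a) = dSec f V (X.presheaf.map i.op a) :=
  PresheafOfModules.DifferentialsConstruction.relativeDifferentials'_map_d
      (constToStructure f) i.op a

/-- `toSections` is the sheafification map, which is locally injective and locally surjective;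
through these two facts sheaf statements become statements about rings. -/
theorem toSections_locally_injective {U : X.Opens} (t : sectionDifferentials f U)
    (h : toSections f U t = 0) (x : X) (hx : x ∈ U) :
    ∃ (V : X.Opens) (_ : x ∈ V) (i : V ⟶ U), resSec f i t = 0 := by
  have := Presheaf.equalizerSieve_mem (Opens.grothendieckTopology X)
    (CategoryTheory.toSheafify (Opens.grothendieckTopology X)
      (presheafDifferentials f).presheaf) (X := op U) t 0 ?_
  · obtain ⟨V, i, hi, hxV⟩ := this x hx
    refine ⟨V, hxV, i, ?_⟩
    have := hi
    simp [Presheaf.equalizerSieve] at this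
    exact this
  · rw [map_zero]
    exact h

theorem toSections_locally_surjective {U : X.Opens} (s : Γ(sheafDifferentials f, U))
    (x : X) (hx : x ∈ U) :
    ∃ (V : X.Opens) (_ : x ∈ V) (i : V ⟶ U) (t : sectionDifferentials f V),
      toSections f V t = (sheafDifferentials f).presheaf.map i.op s := by
  have := Presheaf.imageSieve_mem (Opens.grothendieckTopology X)
    (CategoryTheory.toSheafify (Opens.grothendieckTopology X)
      (presheafDifferentials f).presheaf) (U := op U) s
  obtain ⟨V, i, ⟨t, ht⟩, hxV⟩ := this x hx
  refine ⟨V, hxV, i, t, ?_⟩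
  exact ht

theorem differentials_hom_ext {N : X.Modules} (g h : sheafDifferentials f ⟶ N)
    (H : ∀ U a, g.app U (d f U a) = h.app U (d f U a)) : g = h := by
  apply (PresheafOfModules.sheafificationHomEquiv (𝟙 X.ringCatSheaf.obj)).injective
  apply (PresheafOfModules.DifferentialsConstruction.isUniversal'
    (constToStructure f)).postcomp_injective
  ext U a
  exact H U.unop a

end Differentials

/-! ### Kernel of reduction and `p`-torsion on Kähler differentials. -/

section Flatness

/-- By the equational criterion of flatness, `m` is a combination `∑ a j • y j` with `q * a j = 0`,
and each such `a j` is a multiple of `q`. -/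
theorem exists_eq_smul_of_smul_eq_zero {W M : Type*} [CommRing W] [AddCommGroup M] [Module W M]
    [Module.Flat W M] (q : W) (hq : ∀ w : W, q * w = 0 → ∃ v, w = q * v) (m : M)
    (hm : q • m = 0) : ∃ m', m = q • m' := by
  obtain ⟨n, a, y, h1, h2⟩ := Module.Flat.isTrivialRelation_of_sum_smul_eq_zero
    (ι := Unit) (f := fun _ => q) (x := fun _ => m) (by simpa using hm)
  choose v hv using fun j => hq (a () j) (by simpa using h2 j)
  refine ⟨∑ j, v j • y j, ?_⟩
  rw [Finset.smul_sum]
  refine (h1 ()).trans ?_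
  exact Finset.sum_congr rfl fun j _ => by rw [hv j, mul_smul]

theorem exists_eq_smul_of_one_tmul_eq_zero {A B M : Type*} [CommRing A] [CommRing B] [Algebra A B]
    [AddCommGroup M] [Module A M] (h : Function.Surjective (algebraMap A B)) (q : A)
    (hq : ∀ a : A, algebraMap A B a = 0 → ∃ b, a = q * b) (m : M)
    (hm : (1 : B) ⊗ₜ[A] m = 0) : ∃ m', m = q • m' := by
  have hex := rTensor_exact (R := A) M (f := Submodule.subtype (RingHom.ker (algebraMap A B)))
    (g := Algebra.linearMap A B) (fun a => by simp [RingHom.mem_ker]) h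
  obtain ⟨t, ht⟩ := (hex (1 ⊗ₜ m)).1 (by simpa using hm)
  have key : ∀ t : TensorProduct A (RingHom.ker (algebraMap A B)) M, ∃ m',
      TensorProduct.lid A M (LinearMap.rTensor M (Submodule.subtype
        (RingHom.ker (algebraMap A B))) t) = q • m' := by
    intro t
    induction t with
    | zero => exact ⟨0, by simp⟩
    | tmul a m =>
      obtain ⟨b, hb⟩ := hq a.1 a.2
      exact ⟨b • m, by simp [hb, mul_smul]⟩
    | add x y hx hy =>
      obtain ⟨x', hx⟩ := hx
      obtain ⟨y', hy⟩ := hy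
      exact ⟨x' + y', by rw [map_add, map_add, hx, hy, smul_add]⟩
  obtain ⟨m', hm'⟩ := key t
  exact ⟨m', by rw [← hm', ht]; simp⟩

variable {W k A B : Type u} [CommRing W] [CommRing k] [CommRing A] [CommRing B] [Algebra W k]
  [Algebra W A] [Algebra k B] [Algebra A B] [Algebra W B] [IsScalarTower W k B]
  [IsScalarTower W A B]

/-- The kernel is the image of `B ⊗ Ω[k⁄W]`, which vanishes because `W → k` is onto. -/
theorem kaehlerMap_base_injective (hk : Function.Surjective (algebraMap W k)) :
    Function.Injective (KaehlerDifferential.map W k B B) := by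
  have : Subsingleton Ω[k⁄W] := KaehlerDifferential.subsingleton_of_surjective W k hk
  rw [injective_iff_map_eq_zero]
  intro x hx
  obtain ⟨t, rfl⟩ := (KaehlerDifferential.exact_mapBaseChange_map W k B x).1 hx
  rw [Subsingleton.elim t 0, map_zero]

theorem kaehlerMap_comp (x : Ω[A⁄W]) : KaehlerDifferential.map W k A B x =
    KaehlerDifferential.map W k B B (KaehlerDifferential.map W W A B x) := by
  have hx : x ∈ Submodule.span A (Set.range (KaehlerDifferential.D W A)) := by
    rw [KaehlerDifferential.span_range_derivation]; trivial
  induction hx using Submodule.span_induction with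
  | mem x h => obtain ⟨a, rfl⟩ := h; simp
  | zero => simp
  | add x y _ _ hx hy => rw [map_add, map_add, map_add, hx, hy]
  | smul a x _ hx =>
    rw [map_smul, map_smul, hx, ← algebraMap_smul B a, ← algebraMap_smul B a, map_smul]

/-- In the conormal sequence of `A → B` the map out of the conormal module is zero: `d (q b) = q db
+ b dq`, where `dq = 0` and `q` dies in `B`. Hence `1 ⊗ x = 0`, and right exactness of the tensor
product makes `x` a multiple of `q`. -/
theorem exists_eq_smul_of_kaehlerMap_eq_zero (hk : Function.Surjective (algebraMap W k))
    (h : Function.Surjective (algebraMap A B)) (q : A) (hqW : KaehlerDifferential.D W A q = 0)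
    (hqB : algebraMap A B q = 0) (hq : ∀ a : A, algebraMap A B a = 0 → ∃ b, a = q * b)
    (x : Ω[A⁄W]) (hx : KaehlerDifferential.map W k A B x = 0) : ∃ y, x = q • y := by
  rw [kaehlerMap_comp] at hx
  have h1 : KaehlerDifferential.map W W A B x = 0 :=
    kaehlerMap_base_injective hk (hx.trans (map_zero _).symm)
  refine exists_eq_smul_of_one_tmul_eq_zero h q hq x ?_
  obtain ⟨t, ht⟩ := (KaehlerDifferential.exact_kerCotangentToTensor_mapBaseChange W A B h
    (1 ⊗ₜ x)).1 (by simpa using h1)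
  rw [← ht]
  obtain ⟨⟨a, ha⟩, rfl⟩ := Ideal.toCotangent_surjective _ t
  obtain ⟨b, rfl⟩ := hq a ha
  rw [KaehlerDifferential.kerCotangentToTensor_toCotangent, Derivation.leibniz, hqW, smul_zero,
    add_zero, ← TensorProduct.smul_tmul, Algebra.smul_def, hqB, zero_mul, TensorProduct.zero_tmul]

theorem exists_eq_smul_of_smul_kaehler_eq_zero [Module.Flat W A]
    (hk : Function.Surjective (algebraMap W k))
    (h : Function.Surjective (algebraMap A B)) (q : W)
    (hWk : RingHom.ker (algebraMap W k) = Ideal.span {q}) (hq2 : q * q = 0)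
    (hqW : ∀ w : W, q * w = 0 → ∃ v, w = q * v)
    (hAB : RingHom.ker (algebraMap A B) = Ideal.span {algebraMap W A q})
    [Algebra.FormallySmooth k B]
    (x : Ω[A⁄W]) (hx : q • x = 0) : ∃ y, x = q • y := by
  -- Formal smoothness lifts along the square-zero ideal `(q)` by flatness; then `Ω[A⁄W]` is
  -- projective over `A`, hence flat over `W`.
  have : Algebra.FormallySmooth W A := by
    refine Algebra.FormallySmooth.of_surjective_of_ker_eq_map_of_flat (R' := k) (S' := B) hk h
      ?_ ?_ inferInstance
    · rw [hWk, hAB, Ideal.map_span, Set.image_singleton]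
    · rw [hWk, Ideal.span_singleton_pow, pow_two, hq2, Ideal.span_singleton_eq_bot]
  have : Module.Flat W Ω[A⁄W] := Module.Flat.trans W A Ω[A⁄W]
  exact exists_eq_smul_of_smul_eq_zero q hqW x hx

end Flatness

/-! ### Arithmetic of `p` in `W₂(k)`. -/

section Witt

variable (p : ℕ) [Fact p.Prime] {k : Type u} [Field k]

theorem residueMap_apply (x : TruncatedWittVector p 2 k) : residueMap p k x = x.coeff 0 := rfl

theorem wittFrobenius_apply [CharP k p] (x : TruncatedWittVector p 2 k) :
    wittFrobenius p k x = TruncatedWittVector.mk p fun j => x.coeff j ^ p := rfl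

theorem residueMap_surjective : Function.Surjective (residueMap p k) := fun a =>
  ⟨TruncatedWittVector.mk p fun _ => a, by
    rw [residueMap_apply, TruncatedWittVector.coeff_mk]⟩

/-- In characteristic `p`, multiplication by `p` is Verschiebung composed with Frobenius. -/
theorem truncated_natCast_mul_coeff [CharP k p] (x : TruncatedWittVector p 2 k) :
    ((p : TruncatedWittVector p 2 k) * x).coeff 0 = 0 ∧
      ((p : TruncatedWittVector p 2 k) * x).coeff 1 = x.coeff 0 ^ p := by
  obtain ⟨x, rfl⟩ := WittVector.truncate_surjective p 2 k x
  have : (p : TruncatedWittVector p 2 k) * WittVector.truncate 2 x =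
      WittVector.truncate 2 (x * (p : WittVector p k)) := by rw [map_mul, map_natCast, mul_comm]
  rw [this]
  simp only [WittVector.coeff_truncate]
  exact ⟨WittVector.mul_charP_coeff_zero x, WittVector.mul_charP_coeff_succ x 0⟩

theorem exists_eq_natCast_mul_of_residueMap_eq_zero [IsAlgClosed k] [CharP k p] (x : TruncatedWittVector p 2 k)
    (hx : residueMap p k x = 0) : ∃ y, x = p * y := by
  -- A `p`-th root of the second coordinate. Any vector with first coordinate `a` is a witness,
  -- since `p y` depends on that coordinate alone.
  obtain ⟨a, ha⟩ := IsAlgClosed.exists_pow_nat_eq (x.coeff 1) (Fact.out : p.Prime).pos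
  refine ⟨TruncatedWittVector.mk p fun _ => a, ?_⟩
  obtain ⟨h0, h1⟩ := truncated_natCast_mul_coeff p (TruncatedWittVector.mk p fun _ : Fin 2 => a)
  ext i
  fin_cases i
  · exact hx.trans h0.symm
  · refine ha.symm.trans (Eq.trans ?_ h1.symm)
    simp

theorem residueMap_natCast [CharP k p] : residueMap p k p = 0 := by
  rw [map_natCast, CharP.cast_eq_zero]

theorem ker_residueMap [IsAlgClosed k] [CharP k p] : RingHom.ker (residueMap p k) = Ideal.span {(p : TruncatedWittVector p 2 k)} := by
  ext x
  rw [RingHom.mem_ker, Ideal.mem_span_singleton]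
  constructor
  · intro h; exact exists_eq_natCast_mul_of_residueMap_eq_zero p x h
  · rintro ⟨y, rfl⟩
    rw [map_mul, residueMap_natCast, zero_mul]

theorem truncated_natCast_sq [CharP k p] : (p : TruncatedWittVector p 2 k) * p = 0 := by
  obtain ⟨h0, h1⟩ := truncated_natCast_mul_coeff p (p : TruncatedWittVector p 2 k)
  ext i
  fin_cases i
  · exact h0.trans (by simp)
  · refine h1.trans ?_
    rw [show (p : TruncatedWittVector p 2 k).coeff 0 = 0 from residueMap_natCast p,
      zero_pow (Fact.out : p.Prime).ne_zero]
    simp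

theorem exists_eq_natCast_mul_of_mul_eq_zero [IsAlgClosed k] [CharP k p] (x : TruncatedWittVector p 2 k)
    (hx : (p : TruncatedWittVector p 2 k) * x = 0) : ∃ y, x = p * y := by
  obtain ⟨h0, h1⟩ := truncated_natCast_mul_coeff p x
  refine exists_eq_natCast_mul_of_residueMap_eq_zero p x ?_
  rw [hx] at h1
  exact (pow_eq_zero_iff (Fact.out : p.Prime).ne_zero).1 (h1.symm.trans (by simp))

theorem exists_eq_pow_add [IsAlgClosed k] [CharP k p] (x : TruncatedWittVector p 2 k) : ∃ t y, x = t ^ p + p * y := by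
  obtain ⟨a, ha⟩ := IsAlgClosed.exists_pow_nat_eq (residueMap p k x) (Fact.out : p.Prime).pos
  obtain ⟨t, rfl⟩ := residueMap_surjective p a
  obtain ⟨y, hy⟩ := exists_eq_natCast_mul_of_residueMap_eq_zero p (x - t ^ p)
    (by rw [map_sub, map_pow, ha, sub_self])
  exact ⟨t, y, by rw [← hy]; ring⟩

theorem residueMap_wittFrobenius [CharP k p] (x : TruncatedWittVector p 2 k) :
    residueMap p k (wittFrobenius p k x) = residueMap p k x ^ p := by
  rw [residueMap_apply, residueMap_apply, wittFrobenius_apply, TruncatedWittVector.coeff_mk]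

/-- Two ring homomorphisms out of `W₂(k)` agree if they agree up to a square-zero ideal
killed by `p`. -/
theorem ringHom_truncated_ext [IsAlgClosed k] [CharP k p] {A : Type*} [CommRing A] (α β : TruncatedWittVector p 2 k →+* A)
    (h1 : ∀ w, (p : A) * (α w - β w) = 0) (h2 : ∀ w, (α w - β w) ^ 2 = 0) : α = β := by
  -- With `ε = α t - β t`, the `p`-th power of `ε + β t` differs from that of `β t` by `ε ^ p` and a
  -- multiple of `p ε`, both zero.
  have hp : ∀ t, α t ^ p = β t ^ p := by
    intro t
    obtain ⟨r, hr⟩ := exists_add_pow_prime_eq (Fact.out : p.Prime) (α t - β t) (β t)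
    rw [sub_add_cancel] at hr
    rw [hr, h1, pow_eq_zero_of_le (Fact.out : p.Prime).two_le (h2 t)]
    ring
  ext x
  obtain ⟨t, y, rfl⟩ := exists_eq_pow_add p x
  have := h1 y
  simp only [map_add, map_mul, map_pow, map_natCast, hp]
  linear_combination this

end Witt

/-! ### A characteristic `p` nonvanishing result for Jacobian-type determinants. -/

section Determinant

open Finset

variable {k B ι : Type*} [CommRing k] [CommRing B] [Algebra k B]

theorem derivation_prod [DecidableEq ι] (D : Derivation k B B) (s : Finset ι) (g : ι → B) :
    D (∏ i ∈ s, g i) = ∑ i ∈ s, D (g i) * ∏ j ∈ s.erase i, g j := by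
  induction s using Finset.induction_on with
  | empty => simp
  | insert a s ha ih =>
    rw [prod_insert ha, D.leibniz, ih, sum_insert ha, erase_insert ha, smul_sum, smul_eq_mul,
      mul_comm (∏ i ∈ s, g i), add_comm]
    congr 1
    refine sum_congr rfl fun i hi => ?_
    have hia : i ≠ a := fun h => ha (h ▸ hi)
    rw [erase_insert_of_ne hia.symm, prod_insert (fun h => ha (mem_of_mem_erase h)), smul_eq_mul]
    ring

/-- Multiplication `B ⊗ B → B` intertwines `D ⊗ 1 + 1 ⊗ D` with `D`. The two summands commute, so
the `p`-th power of their sum is the sum of their `p`-th powers up to a multiple of `p`. -/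
theorem derivation_iterate_mul (D : Derivation k B B) (p : ℕ) (hp : p.Prime) (h : (p : B) = 0)
    (a b : B) : ((D : B →ₗ[k] B) ^ p) (a * b) =
      a * ((D : B →ₗ[k] B) ^ p) b + b * ((D : B →ₗ[k] B) ^ p) a := by
  let E : Module.End k (TensorProduct k B B) := LinearMap.rTensor B (D : B →ₗ[k] B)
  let G : Module.End k (TensorProduct k B B) := LinearMap.lTensor B (D : B →ₗ[k] B)
  have hEG : Commute E G := by
    refine TensorProduct.ext' fun x y => ?_
    simp [E, G]
  have h1 : ∀ n, ∀ t, LinearMap.mul' k B (((E + G) ^ n) t) =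
      ((D : B →ₗ[k] B) ^ n) (LinearMap.mul' k B t) := by
    intro n
    induction n with
    | zero => simp
    | succ n ih =>
      intro t
      rw [pow_succ, pow_succ, Module.End.mul_apply, Module.End.mul_apply, ih]
      congr 1
      induction t with
      | zero => simp
      | tmul x y => simp [E, G, D.leibniz]; ring
      | add x y hx hy => rw [map_add, map_add, hx, hy, map_add, map_add]
  obtain ⟨r, hr⟩ := hEG.exists_add_pow_prime_eq hp
  have hE : ∀ n, (E ^ n) (a ⊗ₜ b) = (((D : B →ₗ[k] B) ^ n) a) ⊗ₜ b := fun n => by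
    rw [LinearMap.rTensor_pow, LinearMap.rTensor_tmul]
  have hG : ∀ n, (G ^ n) (a ⊗ₜ b) = a ⊗ₜ (((D : B →ₗ[k] B) ^ n) b) := fun n => by
    rw [LinearMap.lTensor_pow, LinearMap.lTensor_tmul]
  have h2 := h1 p (a ⊗ₜ b)
  rw [hr, LinearMap.mul'_apply] at h2
  rw [← h2, LinearMap.add_apply, LinearMap.add_apply, hE, hG]
  have h3 : ∀ t, LinearMap.mul' k B (((p : Module.End k (TensorProduct k B B)) * E * G * r) t) = 0 := by
    intro t
    rw [mul_assoc, mul_assoc, Module.End.mul_apply, Module.End.natCast_apply, map_nsmul,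
      nsmul_eq_mul, h, zero_mul]
  rw [map_add, h3]
  simp
  ring

variable [Fintype ι] [DecidableEq ι] (D : ι → Derivation k B B)

/-- A determinant with closed rows, one of which is exact, is a divergence. -/
theorem apply_det_eq_zero_of_exact_row (T : B →+ B) (hT : ∀ j b, T (D j b) = 0)
    (y : Matrix ι ι B) (i₀ : ι) (g : B) (hg : ∀ j, y i₀ j = D j g)
    (hy : ∀ i, i ≠ i₀ → ∀ j l, D l (y i j) = D j (y i l)) : T y.det = 0 := by
  let Q : Equiv.Perm ι → B := fun σ => ∏ i ∈ univ.erase i₀, y i (σ i)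
  -- Leibniz applied to `g * Q σ`: the first sum consists of derivatives, which `T` kills; the
  -- second is shown to vanish.
  have h1 : y.det = ∑ σ : Equiv.Perm ι, Equiv.Perm.sign σ • (D (σ i₀) (g * Q σ)) -
      g * ∑ σ : Equiv.Perm ι, Equiv.Perm.sign σ • (D (σ i₀) (Q σ)) := by
    rw [← Matrix.det_transpose, Matrix.det_apply, mul_sum, ← sum_sub_distrib]
    refine sum_congr rfl fun σ _ => ?_
    rw [mul_smul_comm, ← smul_sub]
    congr 1
    rw [← mul_prod_erase univ _ (mem_univ i₀), (D (σ i₀)).leibniz]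
    simp only [Matrix.transpose_apply, hg, Q, smul_eq_mul]
    ring
  have h2 : ∑ σ : Equiv.Perm ι, Equiv.Perm.sign σ • (D (σ i₀) (Q σ)) = 0 := by
    simp only [Q, derivation_prod, smul_sum]
    rw [sum_comm]
    refine sum_eq_zero fun i₁ hi₁ => ?_
    have hne : i₁ ≠ i₀ := ne_of_mem_erase hi₁
    -- Swapping `i₀` and `i₁` exchanges the two indices in `D l (y i₁ j)`; closedness of row `i₁`
    -- and the change of sign make the terms cancel.
    refine sum_involution (fun σ _ => σ * Equiv.swap i₀ i₁) ?_ ?_ (fun _ _ => mem_univ _) ?_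
    · intro σ _
      have : ∏ j ∈ (univ.erase i₀).erase i₁, y j ((σ * Equiv.swap i₀ i₁) j) =
          ∏ j ∈ (univ.erase i₀).erase i₁, y j (σ j) := by
        refine prod_congr rfl fun j hj => ?_
        rw [Equiv.Perm.mul_apply, Equiv.swap_apply_of_ne_of_ne
          (ne_of_mem_erase (mem_of_mem_erase hj)) (ne_of_mem_erase hj)]
      rw [this, Equiv.Perm.mul_apply, Equiv.Perm.mul_apply, Equiv.swap_apply_left,
        Equiv.swap_apply_right, hy i₁ hne, map_mul, Equiv.Perm.sign_swap hne.symm]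
      simp
    · intro σ _ _ h
      have := Equiv.congr_fun (mul_eq_left.1 h) i₀
      rw [Equiv.swap_apply_left] at this
      exact hne this
    · intro σ _
      simp [mul_assoc]
  rw [h1, h2, mul_zero, sub_zero, map_sum]
  refine sum_eq_zero fun σ _ => ?_
  rw [Units.smul_def, map_zsmul, hT, smul_zero]

variable {D}

/-- `T` is the product of `(D j) ^ (p - 1)` over `s`. Each factor turns its `x j ^ (p - 1)` into `(p
- 1)!`, and one more `D j` gives `(D j) ^ p = 0`. -/
theorem exists_extracting_operator (p : ℕ) [hp : Fact p.Prime] (x : ι → B)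
    (hx : ∀ i j, D j (x i) = if i = j then 1 else 0)
    (hcomm : ∀ i j, Commute (D i : B →ₗ[k] B) (D j : B →ₗ[k] B))
    (hpow : ∀ i, (D i : B →ₗ[k] B) ^ p = 0) (s : Finset ι) :
    ∃ T : Module.End k B, (∀ j, Commute T (D j : B →ₗ[k] B)) ∧
      (∀ j ∈ s, T * (D j : B →ₗ[k] B) = 0) ∧
      ∃ n : ℕ, T (∏ i, x i ^ (p - 1)) = (((p - 1).factorial ^ n : ℕ) : B) * ∏ i ∈ sᶜ, x i ^ (p - 1) := by
  induction s using Finset.induction_on with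
  | empty => exact ⟨1, fun j => Commute.one_left _, by simp, 0, by simp⟩
  | insert a s ha ih =>
    obtain ⟨T, h1, h2, n, h3⟩ := ih
    have hp1 : p - 1 + 1 = p := Nat.sub_add_cancel hp.out.one_le
    refine ⟨(D a : B →ₗ[k] B) ^ (p - 1) * T, fun j => ((hcomm a j).pow_left _).mul_left (h1 j), ?_,
      n + 1, ?_⟩
    · intro j hj
      rw [mul_assoc]
      rcases mem_insert.1 hj with rfl | hj
      · rw [(h1 j).eq, ← mul_assoc, ← pow_succ, hp1, hpow, zero_mul]
      · rw [h2 j hj, mul_zero]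
    · have hac : a ∈ sᶜ := by simpa using ha
      rw [Module.End.mul_apply, h3, ← mul_prod_erase _ _ hac]
      have he : (sᶜ).erase a = (insert a s)ᶜ := by ext; simp
      rw [he]
      -- The integer `d` absorbs the exponent released by each differentiation, so the induction
      -- closes.
      have h0 : ∀ c : B, D a c = 0 → ∀ m, ∀ d : ℕ, ((D a : B →ₗ[k] B) ^ m) (d * (x a ^ m * c)) =
          d * m.factorial * c := by
        intro c hc m
        induction m with
        | zero => intro d; simp
        | succ m ihm =>
          intro d
          have : (D a : B →ₗ[k] B) (d * (x a ^ (m + 1) * c)) = ((d * (m + 1) : ℕ) : B) * (x a ^ m * c) := by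
            simp [Derivation.leibniz, Derivation.leibniz_pow, hc, hx]
            ring
          rw [pow_succ, Module.End.mul_apply, this, ihm, Nat.factorial_succ]
          push_cast
          ring
      rw [h0]
      · push_cast
        ring
      · rw [derivation_prod]
        refine sum_eq_zero fun i hi => ?_
        have : i ≠ a := by
          rintro rfl
          simp at hi
        simp [Derivation.leibniz_pow, hx, this]

theorem det_diagonal_add_jacobian_ne_zero [IsDomain B] (p : ℕ) [hp : Fact p.Prime] [CharP B p]
    (x δ : ι → B)
    (hx : ∀ i j, D j (x i) = if i = j then 1 else 0)
    (hcomm : ∀ i j, Commute (D i : B →ₗ[k] B) (D j : B →ₗ[k] B))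
    (hpow : ∀ i, (D i : B →ₗ[k] B) ^ p = 0) :
    (Matrix.of fun i j => (if i = j then x i ^ (p - 1) else 0) + D j (δ i)).det ≠ 0 := by
  obtain ⟨T, -, h2, n, h3⟩ := exists_extracting_operator p x hx hcomm hpow univ
  rw [compl_univ, prod_empty, mul_one] at h3
  have hT : ∀ j b, T.toAddMonoidHom (D j b) = 0 := fun j b =>
    LinearMap.congr_fun (h2 j (mem_univ j)) b
  have hcomm' : ∀ i j b, D i (D j b) = D j (D i b) := fun i j b =>
    LinearMap.congr_fun (hcomm i j).eq b
  -- `N s` drops the exact part from the rows in `s`; it interpolates between the given matrix at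
  -- `∅` and the diagonal one at `univ`.
  let N : Finset ι → Matrix ι ι B := fun s => Matrix.of fun i j =>
    (if i = j then x i ^ (p - 1) else 0) + if i ∈ s then 0 else D j (δ i)
  have key : ∀ s : Finset ι, T (N s).det = T (N ∅).det := by
    intro s
    induction s using Finset.induction_on with
    | empty => rfl
    | insert a s ha ih =>
      have e1 : N s = (N s).updateRow a ((fun j => N (insert a s) a j) + fun j => D j (δ a)) := by
        ext i j
        by_cases h : i = a
        · subst h; simp [N, ha]
        · simp [N, h]
      have e2 : (N s).updateRow a (fun j => N (insert a s) a j) = N (insert a s) := by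
        ext i j
        by_cases h : i = a
        · subst h; simp
        · simp [N, h]
      rw [← ih, e1, Matrix.det_updateRow_add, e2, map_add, left_eq_add]
      refine apply_det_eq_zero_of_exact_row D T.toAddMonoidHom hT _ a (δ a) (by simp) ?_
      intro i hi j l
      rw [Matrix.updateRow_ne hi]
      simp only [N, Matrix.of_apply, map_add]
      -- The remaining rows are closed: `x i ^ (p - 1)` has only its `i`-th partial derivative
      -- possibly nonzero, and mixed partials of `δ i` agree.
      congr 1
      · rcases eq_or_ne i j with rfl | hij <;> rcases eq_or_ne i l with rfl | hil
        · rfl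
        · simp [hil, Derivation.leibniz_pow, hx]
        · simp [hij, Derivation.leibniz_pow, hx]
        · simp [hij, hil]
      · split_ifs
        · simp
        · exact hcomm' _ _ _
  intro h0
  have hN : N ∅ = Matrix.of fun i j => (if i = j then x i ^ (p - 1) else 0) + D j (δ i) := by
    ext i j; simp [N]
  have hu : N univ = Matrix.diagonal fun i => x i ^ (p - 1) := by
    ext i j; simp [N, Matrix.diagonal_apply]
  have := key univ
  rw [hN, h0, map_zero, hu, Matrix.det_diagonal, h3, CharP.cast_eq_zero_iff B p] at this
  have := (Nat.Prime.dvd_factorial hp.out).1 (hp.out.dvd_of_dvd_pow this)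
  have := hp.out.pos
  omega

end Determinant

/-! ### Partial derivatives attached to a basis of exact differentials. -/

section Coordinates

variable {k B ι : Type*} [CommRing k] [CommRing B] [Algebra k B]
  (b : Module.Basis ι B Ω[B⁄k]) (x : ι → B) (hb : ∀ i, b i = KaehlerDifferential.D k B (x i))

/-- The partial derivatives with respect to a basis of the module of differentials. -/
def partialDerivation (j : ι) : Derivation k B B :=
  (b.coord j).compDer (KaehlerDifferential.D k B)

theorem partialDerivation_apply (j : ι) (c : B) :
    partialDerivation b j c = b.repr (KaehlerDifferential.D k B c) j := rfl

include hb in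
theorem derivation_eq_zero_of_coordinates (D : Derivation k B B) (h : ∀ i, D (x i) = 0) :
    D = 0 := by
  have : D.liftKaehlerDifferential = 0 := b.ext fun i => by
    rw [hb, Derivation.liftKaehlerDifferential_comp_D, h, LinearMap.zero_apply]
  ext a
  rw [← Derivation.liftKaehlerDifferential_comp_D D a, this]; rfl

include hb in
theorem partialDerivation_coordinate [DecidableEq ι] (i j : ι) :
    partialDerivation b j (x i) = if i = j then 1 else 0 := by
  rw [partialDerivation_apply, ← hb, b.repr_self, Finsupp.single_apply]

include hb in
-- The commutator is a derivation killing the coordinates, whose partials are constants; so it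
-- vanishes.
theorem partialDerivation_commute (i j : ι) :
    Commute (partialDerivation b i : B →ₗ[k] B) (partialDerivation b j : B →ₗ[k] B) := by
  classical
  have := derivation_eq_zero_of_coordinates b x hb ⁅partialDerivation b i, partialDerivation b j⁆
    (fun l => by
      rw [Derivation.commutator_apply, partialDerivation_coordinate b x hb,
        partialDerivation_coordinate b x hb]
      split_ifs <;> simp)
  refine LinearMap.ext fun a => ?_
  have := DFunLike.congr_fun this a
  rw [Derivation.commutator_apply, Derivation.zero_apply, sub_eq_zero] at this
  exact this

include hb in
-- The `p`-th iterate is again a derivation, and it kills the coordinates because already their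
-- second derivatives vanish.
theorem partialDerivation_pow (p : ℕ) (hp : p.Prime) (h : (p : B) = 0) (i : ι) :
    (partialDerivation b i : B →ₗ[k] B) ^ p = 0 := by
  classical
  have := derivation_eq_zero_of_coordinates b x hb
    (Derivation.mk' ((partialDerivation b i : B →ₗ[k] B) ^ p)
      fun a c => derivation_iterate_mul _ p hp h a c) (fun l => by
      obtain ⟨n, rfl⟩ := Nat.exists_eq_add_of_le hp.two_le
      rw [Derivation.coe_mk', add_comm, pow_add, pow_two, Module.End.mul_apply,
        Module.End.mul_apply, Derivation.coeFn_coe, partialDerivation_coordinate b x hb]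
      split_ifs <;> simp)
  have := congrArg (fun D : Derivation k B B => (D : B →ₗ[k] B)) this
  exact this

include hb in
theorem det_divided_frobenius_ne_zero [Fintype ι] [DecidableEq ι] [IsDomain B] (p : ℕ)
    [hp : Fact p.Prime] [CharP B p] (δ : ι → B) :
    (Matrix.of fun i j => (if i = j then x i ^ (p - 1) else 0) +
      b.repr (KaehlerDifferential.D k B (δ i)) j).det ≠ 0 :=
  det_diagonal_add_jacobian_ne_zero (D := partialDerivation b) p x δ
    (partialDerivation_coordinate b x hb) (partialDerivation_commute b x hb)
    (partialDerivation_pow b x hb p hp.out (CharP.cast_eq_zero B p))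

end Coordinates

/-! ### Torsion and reduction statements for bundled rings. -/

section RingLevel

variable {W k A B : CommRingCat.{u}} (c : W ⟶ A) (c' : k ⟶ B) (r : W ⟶ k) (i : A ⟶ B)

theorem kaehler_induction {c : W ⟶ A} {P : CommRingCat.KaehlerDifferential c → Prop}
    (t : CommRingCat.KaehlerDifferential c)
    (hd : ∀ a, P (CommRingCat.KaehlerDifferential.d (f := c) a))
    (hzero : P 0) (hadd : ∀ x y, P x → P y → P (x + y))
    (hsmul : ∀ (a : A) x, P x → P (a • x)) : P t := by
  let := c.hom.toAlgebra
  have hx : (show Ω[A⁄W] from t) ∈ Submodule.span A (Set.range (KaehlerDifferential.D W A)) := by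
    rw [KaehlerDifferential.span_range_derivation]; trivial
  exact Submodule.span_induction (p := fun x _ => P x)
    (by rintro _ ⟨a, rfl⟩; exact hd a) hzero (fun x y _ _ => hadd x y) (fun a x _ => hsmul a x) hx

theorem exists_eq_nsmul_of_map_eq_zero (fac : r ≫ c' = c ≫ i)
    (hr : Function.Surjective r) (hi : Function.Surjective i) (p : ℕ) (hpB : (p : B) = 0)
    (hker : ∀ a : A, i a = 0 → ∃ b, a = p * b) (x : CommRingCat.KaehlerDifferential c)
    (hx : CommRingCat.KaehlerDifferential.map fac x = 0) : ∃ y, x = p • y := by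
  algebraize [c.hom, c'.hom, r.hom, i.hom, c'.hom.comp r.hom]
  have := IsScalarTower.of_algebraMap_eq' (congrArg CommRingCat.Hom.hom fac)
  obtain ⟨y, hy⟩ := exists_eq_smul_of_kaehlerMap_eq_zero (W := W) (k := k) (A := A) (B := B)
    hr hi (p : A) (Derivation.map_natCast _ p) ((map_natCast _ p).trans hpB) hker x hx
  exact ⟨y, hy.trans (Nat.cast_smul_eq_nsmul A p y)⟩

theorem exists_eq_nsmul_of_nsmul_eq_zero (fac : r ≫ c' = c ≫ i)
    (hr : Function.Surjective r) (hi : Function.Surjective i) (p : ℕ)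
    (hrp : RingHom.ker r.hom = Ideal.span {(p : W)}) (hp2 : (p : W) * p = 0)
    (hpW : ∀ w : W, p * w = 0 → ∃ v, w = p * v)
    (hip : RingHom.ker i.hom = Ideal.span {(p : A)})
    (hc : c.hom.Flat) (hc' : c'.hom.Smooth) (x : CommRingCat.KaehlerDifferential c)
    (hx : p • x = 0) : ∃ y, x = p • y := by
  algebraize [c.hom, c'.hom, r.hom, i.hom, c'.hom.comp r.hom]
  have := IsScalarTower.of_algebraMap_eq' (congrArg CommRingCat.Hom.hom fac)
  obtain ⟨y, hy⟩ := exists_eq_smul_of_smul_kaehler_eq_zero (W := W) (k := k) (A := A) (B := B)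
    hr hi (p : W) hrp hp2 hpW (by rw [map_natCast]; exact hip) x
    ((Nat.cast_smul_eq_nsmul W p _).trans hx)
  exact ⟨y, hy.trans (Nat.cast_smul_eq_nsmul W p y)⟩

end RingLevel

/-! ### Structure maps on affine opens, and the differential of a morphism on sections. -/

section Differentials

variable {R R' : CommRingCat.{u}} {X Y : Scheme.{u}}

theorem constToStructure_eq_appLE (f : X ⟶ Spec R) (U : X.Opens) :
    (constToStructure f).app (op U) = (Scheme.ΓSpecIso R).inv ≫ f.appLE ⊤ U le_top := rfl

theorem constToStructure_flat (f : X ⟶ Spec R) [Flat f] {U : X.Opens} (hU : IsAffineOpen U) :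
    ((constToStructure f).app (op U)).hom.Flat := by
  rw [constToStructure_eq_appLE, CommRingCat.hom_comp]
  exact RingHom.Flat.comp (.of_bijective (ConcreteCategory.bijective_of_isIso _))
    (f.flat_appLE (isAffineOpen_top _) hU _)

theorem constToStructure_smooth (f : X ⟶ Spec R) [Smooth f] {U : X.Opens} (hU : IsAffineOpen U) :
    ((constToStructure f).app (op U)).hom.Smooth := by
  rw [constToStructure_eq_appLE, CommRingCat.hom_comp]
  exact RingHom.Smooth.comp (.of_bijective (ConcreteCategory.bijective_of_isIso _))
    (f.smooth_appLE (isAffineOpen_top _) hU _)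

theorem differential_toSections (f : X ⟶ Spec R') (h : Y ⟶ Spec R) (g : X ⟶ Y)
    (σ : R ⟶ R') (w : g ≫ h = f ≫ Spec.map σ) (U : Y.Opens) (t : sectionDifferentials h U) :
    (differential f h g σ w).app U (toSections h U t) = toSections f (g ⁻¹ᵁ U)
      (CommRingCat.KaehlerDifferential.map (constToStructure_comp f h g σ w U).symm t) := by
  induction t using kaehler_induction with
  | hd a =>
    refine (differential_d f h g σ w U a).trans ?_
    rw [CommRingCat.KaehlerDifferential.map_d]
    rfl
  | hzero =>
    rw [map_zero, map_zero]
    refine Eq.symm ((congrArg (toSections f _) ?_).trans (map_zero _))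
    exact map_zero (CommRingCat.KaehlerDifferential.map
      (constToStructure_comp f h g σ w U).symm).hom
  | hadd x y hx hy =>
    rw [map_add, map_add, hx, hy]
    refine (map_add (toSections f (g ⁻¹ᵁ U)) _ _).symm.trans ?_
    exact congrArg (toSections f _) (map_add (CommRingCat.KaehlerDifferential.map
      (constToStructure_comp f h g σ w U).symm).hom x y).symm
  | hsmul a x hx =>
    rw [toSections_smul, Scheme.Modules.Hom.app_smul, hx]
    refine (toSections_smul f (g ⁻¹ᵁ U) (g.app U a) _).symm.trans ?_
    exact congrArg (toSections f _) (((CommRingCat.KaehlerDifferential.map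
      (constToStructure_comp f h g σ w U).symm).hom.map_smul a x).symm)

end Differentials

/-! ### The ideal of `X` in the lift. -/

namespace FrobeniusLifting

variable {p : ℕ} [Fact p.Prime] {k : Type u} [Field k] [IsAlgClosed k] [CharP k p]
  {X : Scheme.{u}} {f : X ⟶ Spec (.of k)} (L : FrobeniusLifting p f)

instance : Flat L.str := L.flat

instance isClosedImmersion_incl : IsClosedImmersion L.incl := by
  have : IsClosedImmersion (Spec.map (CommRingCat.ofHom (residueMap p k))) :=
    IsClosedImmersion.spec_of_surjective _ (residueMap_surjective p)
  exact MorphismProperty.of_isPullback (P := @IsClosedImmersion) L.isPullback.flip this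

/-- The kernel `(p)` of `W₂(k) → k` is nilpotent, so `Spec k → Spec W₂(k)` is onto, and surjectivity
is stable under base change. -/
instance surjective_incl : Surjective L.incl := by
  have : Surjective (Spec.map (CommRingCat.ofHom (residueMap p k))) := by
    refine ⟨Set.range_eq_univ.1 ((range_comap_of_surjective _ (residueMap p k)
      (residueMap_surjective p)).trans ?_)⟩
    refine Set.eq_univ_of_forall fun x => (PrimeSpectrum.mem_zeroLocus _ _).2 ?_
    rw [ker_residueMap, SetLike.coe_subset_coe, Ideal.span_singleton_le_iff_mem]
    refine x.2.mem_of_pow_mem 2 ?_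
    rw [pow_two, truncated_natCast_sq]
    exact zero_mem _
  exact MorphismProperty.of_isPullback (P := @Surjective) L.isPullback.flip this

theorem natCast_section_eq_zero (f : X ⟶ Spec (.of k)) (U : X.Opens) : (p : Γ(X, U)) = 0 :=
  FrobLift.natCast_section_eq_zero X (natCast_top_eq_zero p f) U

theorem natCast_sq_section_eq_zero (V : L.total.Opens) : (p : Γ(L.total, V)) * p = 0 := by
  have := congrArg ((constToStructure L.str).app (op V)).hom (truncated_natCast_sq p (k := k))
  rwa [map_mul, map_natCast, map_zero] at this

theorem incl_app_surjective {V : L.total.Opens} (hV : IsAffineOpen V) :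
    Function.Surjective (L.incl.app V) := L.incl.app_surjective V hV

/-- On affine opens the cartesian square is a pushout of rings. The quotient map modulo `p` and the
induced map from `k` therefore factor through the ring of `X`, so what dies there dies modulo `p`.
-/
theorem exists_eq_natCast_mul_of_incl_app_eq_zero {V : L.total.Opens} (hV : IsAffineOpen V)
    (a : Γ(L.total, V)) (ha : L.incl.app V a = 0) : ∃ b, a = p * b := by
  have hpo := (isIso_pushoutSection_iff L.isPullback (US := ⊤) (UT := ⊤) (UX := V)
    (UY := L.incl ⁻¹ᵁ V) le_top le_top (by simp)).1
    (isIso_pushoutSection_of_isAffineOpen L.isPullback _ _ _ (isAffineOpen_top _)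
      (isAffineOpen_top _) hV)
  let I : Ideal Γ(L.total, V) := Ideal.span {(p : Γ(L.total, V))}
  let m : Γ(L.total, V) ⟶ CommRingCat.of (Γ(L.total, V) ⧸ I) :=
    CommRingCat.ofHom (Ideal.Quotient.mk I)
  let cW := (constToStructure L.str).app (op V)
  let e : k →+* Γ(L.total, V) ⧸ I := RingHom.liftOfSurjective (residueMap p k)
    (residueMap_surjective p) ⟨(Ideal.Quotient.mk I).comp cW.hom, by
      rw [ker_residueMap, Ideal.span_singleton_le_iff_mem, RingHom.mem_ker, map_natCast]
      rw [← map_natCast (Ideal.Quotient.mk I), Ideal.Quotient.eq_zero_iff_mem]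
      exact Ideal.mem_span_singleton_self _⟩
  have he : ∀ w, e (residueMap p k w) = Ideal.Quotient.mk I (cW w) := fun w =>
    RingHom.liftOfSurjective_comp_apply _ _ _ _
  have hcomm : L.str.appLE ⊤ V le_top ≫ m =
      (Spec.map (CommRingCat.ofHom (residueMap p k))).appLE ⊤ ⊤ le_top ≫
        (Scheme.ΓSpecIso (.of k)).hom ≫ CommRingCat.ofHom e := by
    rw [← cancel_epi (Scheme.ΓSpecIso _).inv, ← Category.assoc, ← constToStructure_eq_appLE]
    have h1 : (Spec.map (CommRingCat.ofHom (residueMap p k))).appLE ⊤ ⊤ le_top =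
      (Spec.map (CommRingCat.ofHom (residueMap p k))).appTop := Scheme.Hom.appLE_eq_app _
    rw [h1, Scheme.ΓSpecIso_naturality_assoc, Iso.inv_hom_id_assoc]
    ext w
    exact (he w).symm
  have h2 := ConcreteCategory.congr_hom (hpo.inl_desc _ _ hcomm) a
  have h3 : L.incl.appLE V (L.incl ⁻¹ᵁ V) (by simp) a = 0 := by
    rw [Scheme.Hom.appLE_eq_app]; exact ha
  have h4 : Ideal.Quotient.mk I a = 0 := by
    refine h2.symm.trans ?_
    rw [CommRingCat.comp_apply, h3, map_zero]
  exact Ideal.mem_span_singleton.1 (Ideal.Quotient.eq_zero_iff_mem.1 h4)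

theorem ker_incl_app {V : L.total.Opens} (hV : IsAffineOpen V) :
    RingHom.ker (L.incl.app V).hom = Ideal.span {(p : Γ(L.total, V))} := by
  ext a
  rw [RingHom.mem_ker, Ideal.mem_span_singleton]
  constructor
  · exact L.exists_eq_natCast_mul_of_incl_app_eq_zero hV a
  · rintro ⟨b, rfl⟩
    rw [map_mul, map_natCast, natCast_section_eq_zero f, zero_mul]

end FrobeniusLifting

/-! ### Morphisms of modules on sections, and direct images. -/

section Modules
open Scheme.Modules
variable {X Y : Scheme.{u}} {M N : X.Modules}

theorem nsmul_app (n : ℕ) (φ : M ⟶ N) (U : X.Opens) (s : Γ(M, U)) :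
    (n • φ).app U s = n • φ.app U s := by
  induction n with
  | zero => rw [zero_smul, zero_smul]; rfl
  | succ n ih =>
    rw [succ_nsmul, succ_nsmul, ← ih]; rfl

theorem app_injective_of_mono (φ : M ⟶ N) [Mono φ] (U : X.Opens) :
    Function.Injective (φ.app U) := by
  have : Mono (φ.mapPresheaf) := inferInstanceAs (Mono ((toPresheaf X).map φ))
  have : Mono (φ.mapPresheaf.app (op U)) := inferInstance
  exact (AddCommGrpCat.mono_iff_injective _).1 this

theorem mono_of_app_injective (φ : M ⟶ N) (h : ∀ U s, φ.app U s = 0 → s = 0) : Mono φ := by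
  refine Preadditive.mono_of_cancel_zero _ fun {K} g hg => modules_hom_ext _ _ fun U s => ?_
  exact h U _ (congrArg (fun q : K ⟶ N => q.app U s) hg)

theorem res_res {U V W : X.Opens} (i : V ⟶ U) (j : W ⟶ V) (s : Γ(M, U)) :
    M.presheaf.map j.op (M.presheaf.map i.op s) = M.presheaf.map (j ≫ i).op s := by
  rw [op_comp, Functor.map_comp]; rfl

theorem structure_res_res {U V W : X.Opens} (i : V ⟶ U) (j : W ⟶ V) (s : Γ(X, U)) :
    X.presheaf.map j.op (X.presheaf.map i.op s) = X.presheaf.map (j ≫ i).op s := by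
  rw [op_comp, Functor.map_comp]; rfl

theorem pushforward_smul (g : X ⟶ Y) (V : Y.Opens) (r : Γ(Y, V))
    (s : Γ((pushforward g).obj M, V)) :
    r • s = (g.app V r • (show Γ(M, g ⁻¹ᵁ V) from s) : Γ(M, g ⁻¹ᵁ V)) :=
  rfl

theorem exists_opens_preimage_eq (g : X ⟶ Y) [IsClosedImmersion g] (U : X.Opens) : ∃ V : Y.Opens, g ⁻¹ᵁ V = U := by
  obtain ⟨V, hV, h⟩ := g.isClosedEmbedding.isInducing.isOpen_iff.1 U.2
  exact ⟨⟨V, hV⟩, Opens.ext h⟩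

end Modules

section Differentials

variable {R R' : CommRingCat.{u}} {X Y : Scheme.{u}} (f : X ⟶ Spec R)

theorem resSec_resSec {U V W : X.Opens} (i : V ⟶ U) (j : W ⟶ V) (t : sectionDifferentials f U) :
    resSec f j (resSec f i t) = resSec f (j ≫ i) t := by
  induction t using kaehler_induction with
  | hd a =>
    refine (congrArg (resSec f j) (resSec_d f i a)).trans ?_
    refine (resSec_d f j _).trans (Eq.trans ?_ (resSec_d f (j ≫ i) a).symm)
    rw [structure_res_res]
  | hzero => simp only [map_zero]
  | hadd x y hx hy => simp only [map_add, hx, hy]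
  | hsmul a x hx =>
    rw [resSec_smul, resSec_smul, resSec_smul, hx, structure_res_res]

end Differentials

/-! ### The reduction map on differentials and multiplication by `p`. -/

namespace FrobeniusLifting

open Scheme.Modules

variable {p : ℕ} [Fact p.Prime] {k : Type u} [Field k] [IsAlgClosed k] [CharP k p]
  {X : Scheme.{u}} {f : X ⟶ Spec (.of k)} (L : FrobeniusLifting p f)

/-- Arbitrarily small affine neighbourhoods of a point of the total space, given a
neighbourhood of the corresponding point of `X`. -/
theorem exists_affine_nhd {V : L.total.Opens} (U : X.Opens) (x : X) (hx : x ∈ U)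
    (hxV : L.incl x ∈ V) : ∃ V' : L.total.Opens, IsAffineOpen V' ∧ L.incl x ∈ V' ∧ V' ≤ V ∧
      L.incl ⁻¹ᵁ V' ≤ U := by
  obtain ⟨V1, rfl⟩ := exists_opens_preimage_eq L.incl U
  obtain ⟨V', h1, h2, h3⟩ := exists_isAffineOpen_mem_and_subset (U := V ⊓ V1) (x := L.incl x)
    ⟨hxV, hx⟩
  exact ⟨V', h1, h2, fun y hy => (h3 hy).1, fun y hy => (h3 hy).2⟩

/-- The reduction map on differentials of rings of sections. -/
def redSec (V : L.total.Opens) :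
    sectionDifferentials L.str V →+ sectionDifferentials f (L.incl ⁻¹ᵁ V) :=
  (CommRingCat.KaehlerDifferential.map
    (constToStructure_comp f L.str L.incl _ L.isPullback.w V).symm).hom.toAddMonoidHom

theorem reduction_toSections (V : L.total.Opens) (t : sectionDifferentials L.str V) :
    L.reduction.app V (toSections L.str V t) = toSections f (L.incl ⁻¹ᵁ V) (L.redSec V t) :=
  differential_toSections f L.str L.incl _ L.isPullback.w V t

theorem redSec_smul (V : L.total.Opens) (a : Γ(L.total, V)) (t : sectionDifferentials L.str V) :
    L.redSec V (a • t) = L.incl.app V a • L.redSec V t :=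
  (CommRingCat.KaehlerDifferential.map
    (constToStructure_comp f L.str L.incl _ L.isPullback.w V).symm).hom.map_smul a t

theorem redSec_d (V : L.total.Opens) (a : Γ(L.total, V)) :
    L.redSec V (dSec L.str V a) = dSec f (L.incl ⁻¹ᵁ V) (L.incl.app V a) :=
  CommRingCat.KaehlerDifferential.map_d
    (constToStructure_comp f L.str L.incl _ L.isPullback.w V).symm a

theorem incl_app_res {V V' : L.total.Opens} (i : V' ⟶ V) (a : Γ(L.total, V)) :
    L.incl.app V' (L.total.presheaf.map i.op a) =
      X.presheaf.map ((Opens.map L.incl.base).map i).op (L.incl.app V a) :=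
  ConcreteCategory.congr_hom (L.incl.naturality i.op) a

theorem redSec_res {V V' : L.total.Opens} (i : V' ⟶ V) (t : sectionDifferentials L.str V) :
    L.redSec V' (resSec L.str i t) =
      resSec f ((Opens.map L.incl.base).map i) (L.redSec V t) := by
  induction t using kaehler_induction with
  | hd a =>
    refine (congrArg (L.redSec V') (resSec_d L.str i a)).trans ?_
    refine (L.redSec_d V' _).trans ?_
    refine Eq.trans ?_ (congrArg (resSec f _) (L.redSec_d V a)).symm
    refine Eq.trans ?_ (resSec_d f _ _).symm
    rw [incl_app_res]
  | hzero => simp only [map_zero]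
  | hadd x y hx hy => simp only [map_add, hx, hy]
  | hsmul a x hx =>
    rw [resSec_smul, redSec_smul, redSec_smul, resSec_smul, hx, incl_app_res]

theorem redSec_surjective {V : L.total.Opens} (hV : IsAffineOpen V) :
    Function.Surjective (L.redSec V) := by
  intro t
  induction t using kaehler_induction with
  | hd a =>
    obtain ⟨b, rfl⟩ := L.incl_app_surjective hV a
    exact ⟨dSec L.str V b, L.redSec_d V b⟩
  | hzero => exact ⟨0, map_zero _⟩
  | hadd x y hx hy =>
    obtain ⟨x', rfl⟩ := hx
    obtain ⟨y', rfl⟩ := hy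
    exact ⟨x' + y', map_add _ _ _⟩
  | hsmul a x hx =>
    obtain ⟨x', rfl⟩ := hx
    obtain ⟨b, rfl⟩ := L.incl_app_surjective hV a
    exact ⟨b • x', L.redSec_smul V b x'⟩

theorem exists_eq_nsmul_of_redSec_eq_zero {V : L.total.Opens} (hV : IsAffineOpen V)
    (t : sectionDifferentials L.str V) (ht : L.redSec V t = 0) : ∃ t', t = p • t' :=
  exists_eq_nsmul_of_map_eq_zero _ _ _ _
    (constToStructure_comp f L.str L.incl _ L.isPullback.w V).symm
    (residueMap_surjective p) (L.incl_app_surjective hV) p (natCast_section_eq_zero f _)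
    (L.exists_eq_natCast_mul_of_incl_app_eq_zero hV) t ht

theorem exists_eq_nsmul_of_nsmul_eq_zero [Smooth f] {V : L.total.Opens} (hV : IsAffineOpen V)
    (t : sectionDifferentials L.str V) (ht : p • t = 0) : ∃ t', t = p • t' :=
  FrobLift.exists_eq_nsmul_of_nsmul_eq_zero _ _ _ _
    (constToStructure_comp f L.str L.incl _ L.isPullback.w V).symm
    (residueMap_surjective p) (L.incl_app_surjective hV) p (ker_residueMap p)
    (truncated_natCast_sq p) (exists_eq_natCast_mul_of_mul_eq_zero p) (L.ker_incl_app hV)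
    (constToStructure_flat L.str hV)
    (constToStructure_smooth f (hV.preimage L.incl)) t ht

theorem nsmul_section_eq_zero (M : X.Modules) (f : X ⟶ Spec (.of k)) (U : X.Opens) (s : Γ(M, U)) :
    p • s = 0 := by
  rw [← Nat.cast_smul_eq_nsmul Γ(X, U), natCast_section_eq_zero f, zero_smul]

theorem sq_nsmul_section_eq_zero (M : L.total.Modules) (V : L.total.Opens) (s : Γ(M, V)) :
    p • p • s = 0 := by
  rw [← Nat.cast_smul_eq_nsmul Γ(L.total, V), ← Nat.cast_smul_eq_nsmul Γ(L.total, V) p s,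
    smul_smul, natCast_sq_section_eq_zero, zero_smul]

theorem exists_section_of_reduction_eq_zero {V : L.total.Opens}
    (s : Γ(sheafDifferentials L.str, V)) (hs : L.reduction.app V s = 0) (y : L.total)
    (hy : y ∈ V) : ∃ (V' : L.total.Opens) (_ : y ∈ V') (i : V' ⟶ V)
      (s' : Γ(sheafDifferentials L.str, V')),
      (sheafDifferentials L.str).presheaf.map i.op s = p • s' := by
  obtain ⟨x, rfl⟩ := L.incl.surjective y
  obtain ⟨V1, hx1, i1, t, ht⟩ := toSections_locally_surjective L.str s _ hy
  have h1 : toSections f _ (L.redSec V1 t) = 0 := by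
    rw [← reduction_toSections, ht, app_res, hs, map_zero]
    rfl
  obtain ⟨U2, hx2, i2, h2⟩ := toSections_locally_injective f _ h1 x hx1
  obtain ⟨V3, hV3, hx3, h31, h32⟩ := L.exists_affine_nhd U2 x hx2 hx1
  have h3 : L.redSec V3 (resSec L.str (homOfLE h31) t) = 0 := by
    rw [redSec_res]
    refine Eq.trans ?_ ((resSec_resSec f i2 (homOfLE h32) (L.redSec V1 t)).symm.trans
      ((congrArg _ h2).trans (map_zero _)))
    rfl
  obtain ⟨t', ht'⟩ := L.exists_eq_nsmul_of_redSec_eq_zero hV3 _ h3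
  refine ⟨V3, hx3, homOfLE h31 ≫ i1, toSections L.str V3 t', ?_⟩
  rw [← res_res, ← ht, ← toSections_res, ht', map_nsmul]

/-- Locally `s` is `p` times a section, and `p² = 0`. This lets multiplication by `p` descend along
the reduction map. -/
theorem nsmul_eq_zero_of_reduction_eq_zero {V : L.total.Opens}
    (s : Γ(sheafDifferentials L.str, V)) (hs : L.reduction.app V s = 0) : p • s = 0 := by
  refine section_eq_of_locally_eq _ _ fun y hy => ?_
  obtain ⟨V', hyV, i, s', h⟩ := L.exists_section_of_reduction_eq_zero s hs y hy
  exact ⟨V', hyV, i, by rw [map_nsmul, h, sq_nsmul_section_eq_zero, map_zero]⟩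

/-- By flatness of the differentials `s` is locally `p` times a section, and `p = 0` on `X`. This is
the injectivity of `P`. -/
theorem reduction_eq_zero_of_nsmul_eq_zero [Smooth f] {V : L.total.Opens}
    (s : Γ(sheafDifferentials L.str, V)) (hs : p • s = 0) : L.reduction.app V s = 0 := by
  refine section_eq_of_locally_eq _ _ fun y hy => ?_
  obtain ⟨V1, hx1, i1, t, ht⟩ := toSections_locally_surjective L.str s y hy
  have h1 : toSections L.str V1 (p • t) = 0 := by
    rw [map_nsmul, ht, ← map_nsmul, hs, map_zero]
  obtain ⟨V2, hx2, i2, h2⟩ := toSections_locally_injective L.str _ h1 y hx1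
  obtain ⟨V3, hV3, hx3, h3⟩ := exists_isAffineOpen_mem_and_subset (U := V2) hx2
  have h4 : p • resSec L.str (homOfLE h3 ≫ i2) t = 0 := by
    rw [← map_nsmul, ← resSec_resSec, h2, map_zero]
  obtain ⟨t', ht'⟩ := L.exists_eq_nsmul_of_nsmul_eq_zero hV3 _ h4
  refine ⟨V3, hx3, homOfLE h3 ≫ i2 ≫ i1, ?_⟩
  rw [← app_res, map_zero, ← Category.assoc, ← res_res, ← ht, ← toSections_res, ht', map_nsmul,
    map_nsmul, reduction_toSections]
  exact nsmul_section_eq_zero _ f _ _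

theorem reduction_locally_surjective {V : L.total.Opens}
    (s : Γ((pushforward L.incl).obj (sheafDifferentials f), V)) (y : L.total) (hy : y ∈ V) :
    ∃ (V' : L.total.Opens) (_ : y ∈ V') (i : V' ⟶ V) (s' : Γ(sheafDifferentials L.str, V')),
      L.reduction.app V' s' =
        ((pushforward L.incl).obj (sheafDifferentials f)).presheaf.map i.op s := by
  obtain ⟨x, rfl⟩ := L.incl.surjective y
  obtain ⟨U1, hx1, i1, t, ht⟩ := toSections_locally_surjective f (U := L.incl ⁻¹ᵁ V) s x hy
  obtain ⟨V3, hV3, hx3, h31, h32⟩ := L.exists_affine_nhd U1 x hx1 hy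
  obtain ⟨t', ht'⟩ := L.redSec_surjective hV3 (resSec f (homOfLE h32) t)
  refine ⟨V3, hx3, homOfLE h31, toSections L.str V3 t', ?_⟩
  rw [reduction_toSections, ht', toSections_res, ht]
  exact res_res (M := sheafDifferentials f) i1 (homOfLE h32) s

instance epi_reduction : Epi L.reduction := by
  refine Preadditive.epi_of_cancel_zero _ fun {K} g hg => modules_hom_ext _ _ fun V s => ?_
  refine section_eq_of_locally_eq _ _ fun y hy => ?_
  obtain ⟨V', hyV, i, s', h⟩ := L.reduction_locally_surjective s y hy
  refine ⟨V', hyV, i, ?_⟩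
  rw [← app_res, ← h]
  refine (congrArg (fun q : sheafDifferentials L.str ⟶ K => q.app V' s') hg).trans ?_
  exact (map_zero (K.presheaf.map i.op).hom).symm

theorem comp_eq_zero_of_reduction_eq_zero {N : L.total.Modules}
    (g : sheafDifferentials L.str ⟶ N)
    (h : ∀ V s, L.reduction.app V s = 0 → g.app V s = 0) :
    Limits.kernel.ι L.reduction ≫ g = 0 := by
  refine modules_hom_ext _ _ fun V s => h V _ ?_
  exact congrArg (fun q : Limits.kernel L.reduction ⟶ _ => q.app V s)
    (Limits.kernel.condition L.reduction)

theorem exists_isMulP : ∃ P, L.IsMulP P :=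
  ⟨Abelian.epiDesc L.reduction (p • 𝟙 _) (L.comp_eq_zero_of_reduction_eq_zero _ fun V s hs => by
    rw [nsmul_app]
    exact L.nsmul_eq_zero_of_reduction_eq_zero s hs), Abelian.comp_epiDesc _ _ _⟩

variable {L}
variable {P : (pushforward L.incl).obj (sheafDifferentials f) ⟶ sheafDifferentials L.str}

theorem IsMulP.app_reduction (hP : L.IsMulP P) {V : L.total.Opens}
    (s : Γ(sheafDifferentials L.str, V)) : P.app V (L.reduction.app V s) = p • s :=
  (congrArg (fun q : sheafDifferentials L.str ⟶ _ => q.app V s) hP).trans (nsmul_app _ _ _ _)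

theorem IsMulP.unique (hP : L.IsMulP P) (P' : _ ⟶ _) (hP' : L.IsMulP P') : P' = P :=
  (cancel_epi L.reduction).1 (hP'.trans hP.symm)

theorem IsMulP.mono [Smooth f] (hP : L.IsMulP P) : Mono P := by
  refine mono_of_app_injective _ fun V s hs => section_eq_of_locally_eq _ _ fun y hy => ?_
  obtain ⟨V', hyV, i, s', h⟩ := L.reduction_locally_surjective s y hy
  refine ⟨V', hyV, i, ?_⟩
  rw [map_zero, ← h]
  refine L.reduction_eq_zero_of_nsmul_eq_zero s' ?_
  rw [← hP.app_reduction, h, app_res, hs, map_zero]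

end FrobeniusLifting

/-! ### Full faithfulness of direct image along a surjective closed immersion. -/

section ClosedImmersion
open Scheme.Modules
variable {X Y : Scheme.{u}} (g : X ⟶ Y) [IsClosedImmersion g] [Surjective g] {M N : X.Modules}

theorem le_of_preimage_le {V V' : Y.Opens} (h : g ⁻¹ᵁ V' ≤ g ⁻¹ᵁ V) : V' ≤ V := by
  intro y hy
  obtain ⟨x, rfl⟩ := g.surjective y
  exact h (show x ∈ g ⁻¹ᵁ V' from hy)

/-- The open subset of the target of a homeomorphic closed immersion with given preimage. -/
def opensImage (U : X.Opens) : Y.Opens := (exists_opens_preimage_eq g U).choose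

theorem preimage_opensImage (U : X.Opens) : g ⁻¹ᵁ opensImage g U = U :=
  (exists_opens_preimage_eq g U).choose_spec

variable {g} (ρ : (pushforward g).obj M ⟶ (pushforward g).obj N)

/-- The map on sections over `U` underlying the descent of a morphism of direct images. -/
def descendApp (U : X.Opens) : Γ(M, U) →+ Γ(N, U) :=
  ((N.presheaf.map (homOfLE (preimage_opensImage g U).ge).op).hom.comp
    (ρ.app (opensImage g U)).hom).comp (M.presheaf.map (homOfLE (preimage_opensImage g U).le).op).hom

theorem descendApp_res (U : X.Opens) (W : Y.Opens) (i : g ⁻¹ᵁ W ⟶ U) (s : Γ(M, U)) :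
    N.presheaf.map i.op (descendApp ρ U s) = ρ.app W (M.presheaf.map i.op s) := by
  have hW : W ≤ opensImage g U := le_of_preimage_le g
    (i.le.trans (preimage_opensImage g U).ge)
  have h1 := app_res ρ (homOfLE hW) (M.presheaf.map (homOfLE (preimage_opensImage g U).le).op s)
  have h2 : ((pushforward g).obj M).presheaf.map (homOfLE hW).op
      (M.presheaf.map (homOfLE (preimage_opensImage g U).le).op s) = M.presheaf.map i.op s :=
    res_res (M := M) (homOfLE (preimage_opensImage g U).le)
      ((Opens.map g.base).map (homOfLE hW)) s
  rw [h2] at h1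
  rw [h1]
  exact res_res (M := N) (homOfLE (preimage_opensImage g U).ge) i
    (ρ.app (opensImage g U) (M.presheaf.map (homOfLE (preimage_opensImage g U).le).op s))

/-- The morphism of modules with a given direct image under a homeomorphic closed immersion. -/
def descendHom : M ⟶ N :=
  modulesHomMk (descendApp ρ)
    (fun U r s => by
      refine section_eq_of_locally_eq _ _ fun x hx => ?_
      have hx' : g x ∈ opensImage g U := by
        change x ∈ g ⁻¹ᵁ opensImage g U
        rwa [preimage_opensImage]
      obtain ⟨W, hW, hxW, hWU⟩ := exists_isAffineOpen_mem_and_subset hx'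
      have hle : g ⁻¹ᵁ W ≤ U := fun z hz => by
        rw [← preimage_opensImage g U]; exact hWU hz
      refine ⟨g ⁻¹ᵁ W, hxW, homOfLE hle, ?_⟩
      -- `ρ` is linear only over functions on `Y`; on affine opens every function on `X` lifts to
      -- one.
      obtain ⟨r', hr'⟩ := g.app_surjective W hW (X.presheaf.map (homOfLE hle).op r)
      rw [descendApp_res, Scheme.Modules.map_smul, Scheme.Modules.map_smul, descendApp_res, ← hr']
      exact Scheme.Modules.Hom.app_smul ρ r' (M.presheaf.map (homOfLE hle).op s))
    (fun {U V} i s => by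
      refine section_eq_of_locally_eq _ _ fun x hx => ?_
      refine ⟨g ⁻¹ᵁ opensImage g V, by rwa [preimage_opensImage],
        homOfLE (preimage_opensImage g V).le, ?_⟩
      rw [descendApp_res, res_res, res_res, descendApp_res])

theorem pushforward_map_descendHom : (pushforward g).map (descendHom ρ) = ρ := by
  refine modules_hom_ext _ _ fun V s => ?_
  have := descendApp_res ρ (g ⁻¹ᵁ V) V (𝟙 _) s
  rw [op_id, CategoryTheory.Functor.map_id, CategoryTheory.Functor.map_id] at this
  exact this

theorem pushforward_map_injective {ψ ψ' : M ⟶ N}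
    (h : (pushforward g).map ψ = (pushforward g).map ψ') : ψ = ψ' := by
  refine modules_hom_ext _ _ fun U s => ?_
  obtain ⟨V, rfl⟩ := exists_opens_preimage_eq g U
  exact congrArg (fun q : (pushforward g).obj M ⟶ (pushforward g).obj N => q.app V s) h

end ClosedImmersion

/-! ### Rules for the universal derivation. -/

section Differentials

variable {R : CommRingCat.{u}} {X : Scheme.{u}} (f : X ⟶ Spec R)

theorem d_pow (U : X.Opens) (a : Γ(X, U)) (n : ℕ) :
    d f U (a ^ n) = n • (a ^ (n - 1) • d f U a) := by
  induction n with
  | zero =>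
    rw [pow_zero, zero_smul, ← map_one ((constToStructure f).app (op U)).hom]
    exact d_const f U 1
  | succ n ih =>
    rw [pow_succ, d_mul, ih, Nat.add_sub_cancel, succ_nsmul', smul_comm]
    congr 1
    -- At `n = 0` the truncated exponent `n - 1` is harmless, being multiplied by `0`.
    rcases n with _ | n
    · simp
    · rw [Nat.add_sub_cancel, smul_smul, pow_succ' a n]

theorem d_natCast_mul (U : X.Opens) (n : ℕ) (a : Γ(X, U)) :
    d f U (n * a) = n • d f U a := by
  rw [← nsmul_eq_mul, map_nsmul]

end Differentials

/-! ### Semilinearity of `F` and division of `dF` by `p`. -/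

namespace FrobeniusLifting

open Scheme.Modules

variable {p : ℕ} [Fact p.Prime] {k : Type u} [Field k] [IsAlgClosed k] [CharP k p]
  {X : Scheme.{u}} {f : X ⟶ Spec (.of k)} (L : FrobeniusLifting p f)

/-- The absolute Frobenius fixes every point and the inclusion is onto. Preimages under `F` are thus
only propositionally equal to the original opens, whence the restriction maps along `preimage_F`
below. -/
theorem F_apply (y : L.total) : L.F y = y := by
  obtain ⟨x, rfl⟩ := L.incl.surjective y
  have : (L.incl ≫ L.F) x = (schemeFrobenius p f ≫ L.incl) x := by rw [L.comm]
  exact this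

theorem preimage_F (V : L.total.Opens) : L.F ⁻¹ᵁ V = V := by
  ext y
  change L.F y ∈ V ↔ y ∈ V
  rw [F_apply]

theorem natCast_mul_eq_zero_and_sq_eq_zero {V : L.total.Opens} (a : Γ(L.total, V))
    (ha : L.incl.app V a = 0) : (p : Γ(L.total, V)) * a = 0 ∧ a ^ 2 = 0 := by
  have h : ∀ y ∈ V, ∃ (V' : L.total.Opens) (_ : y ∈ V') (i : V' ⟶ V), ∃ b,
      L.total.presheaf.map i.op a = p * b := by
    intro y hy
    obtain ⟨V', hV', hy', hle⟩ := exists_isAffineOpen_mem_and_subset hy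
    exact ⟨V', hy', homOfLE hle, L.exists_eq_natCast_mul_of_incl_app_eq_zero hV' _
      (by rw [incl_app_res, ha, map_zero])⟩
  constructor
  · refine structure_section_eq_of_locally_eq _ _ fun y hy => ?_
    obtain ⟨V', hy', i, b, hb⟩ := h y hy
    refine ⟨V', hy', i, ?_⟩
    rw [map_mul, map_natCast, hb, ← mul_assoc, natCast_sq_section_eq_zero, zero_mul, map_zero]
  · refine structure_section_eq_of_locally_eq _ _ fun y hy => ?_
    obtain ⟨V', hy', i, b, hb⟩ := h y hy
    refine ⟨V', hy', i, ?_⟩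
    rw [map_pow, hb, mul_pow, pow_two, natCast_sq_section_eq_zero, zero_mul, map_zero]

/-- The target is affine, so global functions suffice. Both maps out of `W₂(k)` become `w ↦
(residueMap w) ^ p` on `X`, and `ringHom_truncated_ext` applies to their difference. -/
theorem isSemilinear : L.IsSemilinear := by
  let α := (Scheme.ΓSpecIso _).inv ≫ (L.F ≫ L.str).appTop
  let β := (Scheme.ΓSpecIso _).inv ≫
    (L.str ≫ Spec.map (CommRingCat.ofHom (wittFrobenius p k))).appTop
  let γ : CommRingCat.of k ⟶ Γ(X, ⊤) := (Scheme.ΓSpecIso _).inv ≫ f.appTop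
  have hα : ∀ w, L.incl.appTop (α w) = (γ (residueMap p k w)) ^ p := by
    have : α ≫ L.incl.appTop = CommRingCat.ofHom (residueMap p k) ≫ γ ≫
        (schemeFrobenius p f).appTop := by
      simp only [α, γ, Category.assoc, ← Scheme.Hom.comp_appTop]
      rw [reassoc_of% L.comm, L.isPullback.w, ← Category.assoc, Scheme.Hom.comp_appTop,
        ← Scheme.ΓSpecIso_inv_naturality_assoc]
    intro w
    exact ConcreteCategory.congr_hom this w
  have hβ : ∀ w, L.incl.appTop (β w) = γ (residueMap p k (wittFrobenius p k w)) := by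
    have : β ≫ L.incl.appTop = CommRingCat.ofHom (wittFrobenius p k) ≫
        CommRingCat.ofHom (residueMap p k) ≫ γ := by
      simp only [β, γ, Category.assoc, ← Scheme.Hom.comp_appTop]
      rw [reassoc_of% L.isPullback.w, Scheme.Hom.comp_appTop, Scheme.Hom.comp_appTop,
        Category.assoc, ← Scheme.ΓSpecIso_inv_naturality_assoc,
        ← Scheme.ΓSpecIso_inv_naturality_assoc]
    intro w
    exact ConcreteCategory.congr_hom this w
  have hker : ∀ w, L.incl.app ⊤ (α w - β w) = 0 := fun w => by
    rw [map_sub]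
    refine sub_eq_zero.2 ((hα w).trans (Eq.trans ?_ (hβ w).symm))
    rw [residueMap_wittFrobenius, map_pow]
  have : α.hom = β.hom := ringHom_truncated_ext p α.hom β.hom
    (fun w => (L.natCast_mul_eq_zero_and_sq_eq_zero _ (hker w)).1)
    (fun w => (L.natCast_mul_eq_zero_and_sq_eq_zero _ (hker w)).2)
  refine ext_of_isAffine ?_
  exact (cancel_epi (Scheme.ΓSpecIso _).inv).1 (CommRingCat.hom_ext this)

theorem incl_app_F_app (V : L.total.Opens) (a : Γ(L.total, V)) :
    L.incl.app (L.F ⁻¹ᵁ V) (L.F.app V a) =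
      (L.incl.app (L.F ⁻¹ᵁ V)
        (L.total.presheaf.map (homOfLE (L.preimage_F V).le).op a)) ^ p := by
  have h := ConcreteCategory.congr_hom (Scheme.Hom.congr_app L.comm V) a
  rw [Scheme.Hom.comp_app, Scheme.Hom.comp_app] at h
  refine h.trans ?_
  rw [incl_app_res, ← map_pow]
  rfl

theorem exists_F_app_eq {V : L.total.Opens} (hV : IsAffineOpen V) (a : Γ(L.total, V)) :
    ∃ b, L.F.app V a =
      (L.total.presheaf.map (homOfLE (L.preimage_F V).le).op a) ^ p + p * b := by
  have hV' : IsAffineOpen (L.F ⁻¹ᵁ V) := by rwa [preimage_F]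
  obtain ⟨b, hb⟩ := L.exists_eq_natCast_mul_of_incl_app_eq_zero hV' (L.F.app V a -
    (L.total.presheaf.map (homOfLE (L.preimage_F V).le).op a) ^ p) (by
      rw [map_sub, map_pow, incl_app_F_app, sub_self])
  exact ⟨b, by rw [← hb]; ring⟩

theorem reduction_d (V : L.total.Opens) (a : Γ(L.total, V)) :
    L.reduction.app V (d L.str V a) = d f (L.incl ⁻¹ᵁ V) (L.incl.app V a) :=
  differential_d f L.str L.incl _ L.isPullback.w V a

variable {L}
variable {P : (pushforward L.incl).obj (sheafDifferentials f) ⟶ sheafDifferentials L.str}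

theorem IsMulP.dF_d (hP : L.IsMulP P) (h : L.IsSemilinear) {V : L.total.Opens}
    (a : Γ(L.total, V)) (z b : Γ(L.total, L.F ⁻¹ᵁ V)) (hb : L.F.app V a = z ^ p + p * b) :
    (L.dF h).app V (d L.str V a) = P.app (L.F ⁻¹ᵁ V) (L.reduction.app _
      (z ^ (p - 1) • d L.str _ z + d L.str _ b)) := by
  refine (differential_d L.str L.str L.F _ h V a).trans ?_
  rw [hb, map_add, d_pow, d_natCast_mul, ← smul_add, hP.app_reduction]

theorem IsMulP.exists_dF_factor [Smooth f] (hP : L.IsMulP P) (h : L.IsSemilinear) :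
    ∃ θ : sheafDifferentials L.str ⟶
        (pushforward L.F).obj ((pushforward L.incl).obj (sheafDifferentials f)),
      θ ≫ (pushforward L.F).map P = L.dF h := by
  have := hP.mono
  have hmono : Mono ((pushforward L.F).map P) := inferInstance
  -- It suffices to test exact differentials locally, where `F a = a ^ p + p b` puts `dF (da)` in
  -- the image of `P`.
  have h0 : L.dF h ≫ Limits.cokernel.π ((pushforward L.F).map P) = 0 := by
    refine differentials_hom_ext _ _ _ fun V a => section_eq_of_locally_eq _ _ fun y hy => ?_
    obtain ⟨V', hV', hy', hle⟩ := exists_isAffineOpen_mem_and_subset hy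
    refine ⟨V', hy', homOfLE hle, ?_⟩
    obtain ⟨b, hb⟩ := L.exists_F_app_eq hV' (L.total.presheaf.map (homOfLE hle).op a)
    rw [← app_res, d_res]
    refine (congrArg ((Limits.cokernel.π ((pushforward L.F).map P)).app V')
      (hP.dF_d h _ _ _ hb)).trans ?_
    refine (congrArg (fun q : (pushforward L.F).obj ((pushforward L.incl).obj
      (sheafDifferentials f)) ⟶ _ => q.app V' _)
      (Limits.cokernel.condition ((pushforward L.F).map P))).trans ?_
    exact (map_zero ((Limits.cokernel ((pushforward L.F).map P)).presheaf.map _).hom).symm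
  exact ⟨Abelian.monoLift _ (L.dF h) h0, Abelian.monoLift_comp _ _ _⟩

theorem IsMulP.exists_isDivided [Smooth f] (hP : L.IsMulP P) (h : L.IsSemilinear) :
    ∃ φ, L.IsDivided h P φ := by
  obtain ⟨θ, hθ⟩ := hP.exists_dF_factor h
  -- The kernel is locally `p` times sections, and `θ` takes values in a module over `X`, where `p =
  -- 0`.
  have h0 : Limits.kernel.ι L.reduction ≫ θ = 0 := by
    refine L.comp_eq_zero_of_reduction_eq_zero _ fun V s hs =>
      section_eq_of_locally_eq _ _ fun y hy => ?_
    obtain ⟨V', hy', i, s', hs'⟩ := L.exists_section_of_reduction_eq_zero s hs y hy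
    refine ⟨V', hy', i, ?_⟩
    rw [← app_res, hs', map_nsmul, map_zero]
    exact nsmul_section_eq_zero (sheafDifferentials f) f _ _
  let ψ := descendHom (g := L.incl) (Abelian.epiDesc L.reduction θ h0 ≫
    (L.pushforwardSquare (sheafDifferentials f)).inv)
  refine ⟨((pullbackPushforwardAdjunction (schemeFrobenius p f)).homEquiv _ _).symm ψ, ?_⟩
  rw [IsDivided, Equiv.apply_symm_apply, pushforward_map_descendHom, Category.assoc,
    Iso.inv_hom_id_assoc, ← Category.assoc, Abelian.comp_epiDesc, hθ]

theorem IsMulP.isDivided_unique [Smooth f] (hP : L.IsMulP P) (h : L.IsSemilinear)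
    {φ φ' : _ ⟶ _} (hφ : L.IsDivided h P φ) (hφ' : L.IsDivided h P φ') : φ' = φ := by
  have := hP.mono
  have hmono : Mono ((pushforward L.F).map P) := inferInstance
  have h1 := hφ'.symm.trans hφ
  rw [cancel_epi, ← Category.assoc, ← Category.assoc, cancel_mono, cancel_mono] at h1
  exact ((pullbackPushforwardAdjunction (schemeFrobenius p f)).homEquiv _ _).injective
    (pushforward_map_injective h1)

theorem incl_preimage_F (V : L.total.Opens) : L.incl ⁻¹ᵁ (L.F ⁻¹ᵁ V) = L.incl ⁻¹ᵁ V := by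
  rw [preimage_F]

theorem pushforwardSquare_hom_app (M : X.Modules) (V : L.total.Opens) (s : Γ(M, L.incl ⁻¹ᵁ V)) :
    (L.pushforwardSquare M).hom.app V s =
      M.presheaf.map (homOfLE (L.incl_preimage_F V).le).op s := by
  simp [pushforwardSquare]
  rfl

end FrobeniusLifting

/-! ### Local coordinates on smooth algebras. -/

section RingLevel

variable {k A B : CommRingCat.{u}} (c : k ⟶ A) (φ : A ⟶ B) (c' : k ⟶ B)

/-- Near the generic point the algebra is standard smooth, and a submersive presentation yields a
basis of exact differentials. Quantifying over all models `B` of the localization lets it apply to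
sections over a basic open. -/
theorem exists_basis_kaehler_of_smooth [IsDomain A] (hc : c.hom.Smooth) :
    ∃ g : A, g ≠ 0 ∧ ∀ (B : CommRingCat.{u}) (φ : A ⟶ B) (c' : k ⟶ B), c ≫ φ = c' →
      (letI := φ.hom.toAlgebra; IsLocalization.Away g B) →
      ∃ (ι : Type) (_ : Fintype ι) (b : Module.Basis ι B (CommRingCat.KaehlerDifferential c'))
        (x : ι → B), ∀ i, b i = CommRingCat.KaehlerDifferential.d (f := c') (x i) := by
  algebraize [c.hom]
  have : (⊥ : Ideal A).IsPrime := Ideal.isPrime_bot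
  obtain ⟨g, hg, hstd⟩ := Algebra.IsSmoothAt.exists_notMem_isStandardSmooth k (⊥ : Ideal A)
  refine ⟨g, fun h => hg h, ?_⟩
  rintro B φ _ rfl hB
  algebraize [φ.hom, (c ≫ φ).hom]
  have : IsScalarTower k A B := .of_algebraMap_eq' rfl
  have hB' : IsLocalization.Away g B := hB
  have : Algebra.IsStandardSmooth k B := .of_algEquiv
    ((Localization.algEquiv (Submonoid.powers g) B).restrictScalars k)
  obtain ⟨ι, σ, _, hι, ⟨P⟩⟩ := this.out
  classical
  exact ⟨_, Fintype.ofFinite _, P.basisKaehler, fun i => P.val i, P.basisKaehler_apply⟩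

theorem exists_basis_kaehler_of_isLocalization (h : c ≫ φ = c') (g : A)
    (hB : letI := φ.hom.toAlgebra; IsLocalization.Away g B) {ι : Type}
    (b : Module.Basis ι A (CommRingCat.KaehlerDifferential c)) (x : ι → A)
    (hb : ∀ i, b i = CommRingCat.KaehlerDifferential.d (f := c) (x i)) :
    ∃ b' : Module.Basis ι B (CommRingCat.KaehlerDifferential c'),
      ∀ i, b' i = CommRingCat.KaehlerDifferential.d (f := c') (φ (x i)) := by
  subst h
  algebraize [c.hom, φ.hom, (c ≫ φ).hom]
  have : IsScalarTower k A B := .of_algebraMap_eq' rfl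
  have hB' : IsLocalization (Submonoid.powers g) B := hB
  have := KaehlerDifferential.isLocalizedModule_map k A B (Submonoid.powers g)
  refine ⟨Module.Basis.ofIsLocalizedModule B (Submonoid.powers g) (KaehlerDifferential.map k k A B)
    (show Module.Basis ι A Ω[A⁄k] from b), fun i => ?_⟩
  refine (Module.Basis.ofIsLocalizedModule_apply B (Submonoid.powers g)
    (KaehlerDifferential.map k k A B) (show Module.Basis ι A Ω[A⁄k] from b) i).trans ?_
  refine (congrArg (KaehlerDifferential.map k k A B) (hb i)).trans ?_
  exact KaehlerDifferential.map_D k k A B (x i)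

end RingLevel

/-! ### Bases of a sheaf of modules over an open set. -/

section Basis
open Scheme.Modules
variable {X : Scheme.{u}} {M N : X.Modules} {ι : Type} [Fintype ι]

/-- The sections `e` of `M` over `U` form a basis of the restriction of `M` to `U`. -/
def IsBasisOn {U : X.Opens} (e : ι → Γ(M, U)) : Prop :=
  ∀ (V : X.Opens) (i : V ⟶ U),
    Function.Bijective fun a : ι → Γ(X, V) => ∑ j, a j • M.presheaf.map i.op (e j)

theorem IsBasisOn.res {U V : X.Opens} {e : ι → Γ(M, U)} (he : IsBasisOn e) (i : V ⟶ U) :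
    IsBasisOn fun j => M.presheaf.map i.op (e j) := by
  intro W j
  simp only [res_res]
  exact he W (j ≫ i)

theorem IsBasisOn.of_isUnit_det [DecidableEq ι] {U : X.Opens} {e y : ι → Γ(M, U)}
    (he : IsBasisOn e) (A : Matrix ι ι Γ(X, U)) (hA : IsUnit A.det)
    (hy : ∀ i, y i = ∑ j, A i j • e j) : IsBasisOn y := by
  intro V i
  let A' := (X.presheaf.map i.op).hom.mapMatrix A
  have hA' : IsUnit A' := by
    rw [Matrix.isUnit_iff_isUnit_det, ← RingHom.map_det]
    exact hA.map _
  have hbij : Function.Bijective A'.vecMul :=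
    ⟨Matrix.vecMul_injective_of_isUnit hA', Matrix.vecMul_surjective_iff_exists_left_inverse.2
      (by obtain ⟨u, hu⟩ := hA'; exact ⟨↑u⁻¹, by rw [← hu]; simp⟩)⟩
  convert (he V i).comp hbij using 1
  funext a
  simp only [Function.comp_apply, hy, map_sum, Scheme.Modules.map_smul, Finset.smul_sum, smul_smul,
    Matrix.vecMul, dotProduct, Finset.sum_smul]
  exact Finset.sum_comm

end Basis

/-! ### Coordinates give a basis of the sheaf of differentials. -/

section Differentials

variable {R : CommRingCat.{u}} {X : Scheme.{u}} (f : X ⟶ Spec R)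

/-- Differentials commute with localization, so the `dx i` stay a basis over each basic open.
Uniqueness of coordinates is then local, and it makes locally found coordinates agree on overlaps
and glue. -/
theorem isBasisOn_d {U : X.Opens} (hU : IsAffineOpen U) {ι : Type} [Fintype ι]
    (b : Module.Basis ι Γ(X, U) (sectionDifferentials f U)) (x : ι → Γ(X, U))
    (hb : ∀ i, b i = dSec f U (x i)) : IsBasisOn fun i => d f U (x i) := by
  have hbasic : ∀ g : Γ(X, U), ∃ b' : Module.Basis ι Γ(X, X.basicOpen g)
      (sectionDifferentials f (X.basicOpen g)), ∀ i, b' i = dSec f _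
        (X.presheaf.map (homOfLE (X.basicOpen_le g)).op (x i)) := by
    intro g
    refine exists_basis_kaehler_of_isLocalization _
      (X.presheaf.map (homOfLE (X.basicOpen_le g)).op) _ ?_ g (hU.isLocalization_basicOpen g)
      b x hb
    exact ((constToStructure f).naturality (homOfLE (X.basicOpen_le g)).op).symm.trans
      (Category.id_comp _)
  have hnhd : ∀ V ≤ U, ∀ z ∈ V, ∃ g : Γ(X, U), z ∈ X.basicOpen g ∧ X.basicOpen g ≤ V := by
    intro V hVU z hz
    obtain ⟨g, h1, h2⟩ := hU.exists_basicOpen_le ⟨z, hz⟩ (hVU hz)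
    exact ⟨g, h2, h1⟩
  have hsum : ∀ {V : X.Opens} (i : V ⟶ U) (a : ι → Γ(X, V)),
      ∑ j, a j • (sheafDifferentials f).presheaf.map i.op (d f U (x j)) =
        toSections f V (∑ j, a j • dSec f V (X.presheaf.map i.op (x j))) := by
    intro V i a
    rw [map_sum]
    exact Finset.sum_congr rfl fun j _ => by rw [toSections_smul, toSections_d, d_res]
  have hres : ∀ {V W : X.Opens} (i : V ⟶ U) (j : W ⟶ V) (a : ι → Γ(X, V)),
      resSec f j (∑ l, a l • dSec f V (X.presheaf.map i.op (x l))) =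
        ∑ l, X.presheaf.map j.op (a l) • dSec f W (X.presheaf.map (j ≫ i).op (x l)) := by
    intro V W i j a
    rw [map_sum]
    exact Finset.sum_congr rfl fun l _ => by rw [resSec_smul, resSec_d, structure_res_res]
  have hinj : ∀ (V : X.Opens) (i : V ⟶ U), Function.Injective fun a : ι → Γ(X, V) =>
      ∑ j, a j • (sheafDifferentials f).presheaf.map i.op (d f U (x j)) := by
    intro V i
    have key : ∀ a : ι → Γ(X, V),
        ∑ j, a j • (sheafDifferentials f).presheaf.map i.op (d f U (x j)) = 0 → a = 0 := by
      intro a ha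
      funext l
      refine structure_section_eq_of_locally_eq _ _ fun z hz => ?_
      obtain ⟨W, hzW, j, hj⟩ := toSections_locally_injective f _ ((hsum i a).symm.trans ha) z hz
      obtain ⟨g, hzg, hgW⟩ := hnhd W (j ≫ i).le z hzW
      obtain ⟨b', hb'⟩ := hbasic g
      refine ⟨X.basicOpen g, hzg, homOfLE hgW ≫ j, ?_⟩
      have h0 := congrArg (resSec f (homOfLE hgW)) hj
      rw [resSec_resSec, map_zero, hres] at h0
      have h1 := Fintype.linearIndependent_iff.1 b'.linearIndependent
        (fun l => X.presheaf.map (homOfLE hgW ≫ j).op (a l))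
        (Eq.trans (Finset.sum_congr rfl fun l _ => by rw [hb']; rfl) h0) l
      rw [Pi.zero_apply, map_zero]
      exact h1
    intro a a' h
    refine sub_eq_zero.1 (key _ ?_)
    simp only [Pi.sub_apply, sub_smul, Finset.sum_sub_distrib]
    exact sub_eq_zero.2 h
  refine fun V i => ⟨hinj V i, fun s => ?_⟩
  have hloc : ∀ z : V, ∃ (W : X.Opens) (_ : z.1 ∈ W) (j : W ⟶ V) (a : ι → Γ(X, W)),
      ∑ l, a l • (sheafDifferentials f).presheaf.map (j ≫ i).op (d f U (x l)) =
        (sheafDifferentials f).presheaf.map j.op s := by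
    intro z
    obtain ⟨W, hzW, j, t, ht⟩ := toSections_locally_surjective f s z.1 z.2
    obtain ⟨g, hzg, hgW⟩ := hnhd W (j ≫ i).le z hzW
    obtain ⟨b', hb'⟩ := hbasic g
    refine ⟨X.basicOpen g, hzg, homOfLE hgW ≫ j, b'.repr (resSec f (homOfLE hgW) t), ?_⟩
    rw [hsum, ← res_res, ← ht, ← toSections_res]
    refine congrArg (toSections f _) (Eq.trans ?_ (b'.sum_repr _))
    exact Finset.sum_congr rfl fun l _ => by rw [hb']; rfl
  choose W hzW j a ha using hloc
  have hcompat : ∀ l, TopCat.Presheaf.IsCompatible X.sheaf.1 W fun z => a z l := by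
    intro l z z'
    have h1 := hinj (W z ⊓ W z') (Opens.infLELeft _ _ ≫ j z ≫ i)
      (a₁ := fun l => X.presheaf.map (Opens.infLELeft _ _).op (a z l))
      (a₂ := fun l => X.presheaf.map (Opens.infLERight _ _).op (a z' l)) ?_
    · exact congrFun h1 l
    · have h2 : ∀ {W₁ W₂ : X.Opens} (i₁ : W₁ ⟶ W₂) (i₂ : W₂ ⟶ U) (a : ι → Γ(X, W₂)),
          ∑ l, X.presheaf.map i₁.op (a l) •
            (sheafDifferentials f).presheaf.map (i₁ ≫ i₂).op (d f U (x l)) =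
          (sheafDifferentials f).presheaf.map i₁.op
            (∑ l, a l • (sheafDifferentials f).presheaf.map i₂.op (d f U (x l))) := by
        intro W₁ W₂ i₁ i₂ a
        rw [map_sum]
        exact Finset.sum_congr rfl fun l _ => by rw [Scheme.Modules.map_smul, res_res]
      refine (h2 (Opens.infLELeft _ _) (j z ≫ i) (a z)).trans ?_
      refine Eq.trans ?_ (h2 (Opens.infLERight _ _) (j z' ≫ i) (a z')).symm
      rw [ha, ha, res_res, res_res]
      rfl
  have hglue := fun l => (TopCat.Sheaf.existsUnique_gluing' X.sheaf W V j
    (fun z hz => Opens.mem_iSup.2 ⟨⟨z, hz⟩, hzW ⟨z, hz⟩⟩) _ (hcompat l)).exists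
  choose a' ha' using hglue
  have ha'' : ∀ l z, X.presheaf.map (j z).op (a' l) = a z l := ha'
  let a'' : ι → Γ(X, V) := a'
  refine ⟨a'', section_eq_of_locally_eq _ _ fun z hz => ⟨W ⟨z, hz⟩, hzW _, j _, ?_⟩⟩
  rw [← ha, map_sum]
  refine Finset.sum_congr rfl fun l _ => ?_
  rw [Scheme.Modules.map_smul, res_res]
  exact congrArg (· • _) (ha'' l ⟨z, hz⟩)

end Differentials

/-! ### Morphisms defined on a basis. -/

section Restrict
open Scheme.Modules
variable {X : Scheme.{u}} {M N : X.Modules} {ι : Type} [Fintype ι] {U : X.Opens}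

/-- The linear coordinates with respect to a basis over `U`. -/
def IsBasisOn.equiv {e : ι → Γ(M, U)} (he : IsBasisOn e) {V : X.Opens} (i : V ⟶ U) :
    (ι → Γ(X, V)) ≃ₗ[Γ(X, V)] Γ(M, V) :=
  LinearEquiv.ofBijective
    (Fintype.linearCombination Γ(X, V) fun j => M.presheaf.map i.op (e j)) (he V i)

theorem IsBasisOn.equiv_apply {e : ι → Γ(M, U)} (he : IsBasisOn e) {V : X.Opens} (i : V ⟶ U)
    (a : ι → Γ(X, V)) : he.equiv i a = ∑ j, a j • M.presheaf.map i.op (e j) := rfl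

theorem sum_smul_res {V W : X.Opens} (e : ι → Γ(M, U)) (i : V ⟶ U) (j : W ⟶ V)
    (a : ι → Γ(X, V)) : M.presheaf.map j.op (∑ l, a l • M.presheaf.map i.op (e l)) =
      ∑ l, X.presheaf.map j.op (a l) • M.presheaf.map (j ≫ i).op (e l) := by
  rw [map_sum]
  exact Finset.sum_congr rfl fun l _ => by rw [Scheme.Modules.map_smul, res_res]

/-- The linear map on sections sending a basis to given sections. -/
def IsBasisOn.liftApp {e : ι → Γ(M, U)} (he : IsBasisOn e) (z : ι → Γ(N, U)) {V : X.Opens}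
    (i : V ⟶ U) : Γ(M, V) →ₗ[Γ(X, V)] Γ(N, V) :=
  (Fintype.linearCombination Γ(X, V) fun j => N.presheaf.map i.op (z j)) ∘ₗ (he.equiv i).symm

theorem IsBasisOn.liftApp_sum {e : ι → Γ(M, U)} (he : IsBasisOn e) (z : ι → Γ(N, U)) {V : X.Opens}
    (i : V ⟶ U) (a : ι → Γ(X, V)) : he.liftApp z i (∑ j, a j • M.presheaf.map i.op (e j)) =
      ∑ j, a j • N.presheaf.map i.op (z j) := by
  rw [← he.equiv_apply, liftApp, LinearMap.comp_apply, LinearEquiv.coe_coe,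
    LinearEquiv.symm_apply_apply]
  rfl

theorem IsBasisOn.liftApp_apply {e : ι → Γ(M, U)} (he : IsBasisOn e) (z : ι → Γ(N, U))
    {V : X.Opens} (i : V ⟶ U) (j : ι) :
    he.liftApp z i (M.presheaf.map i.op (e j)) = N.presheaf.map i.op (z j) := by
  classical
  simpa [Pi.single_apply, ite_smul] using he.liftApp_sum z i (Pi.single j 1)

theorem IsBasisOn.liftApp_res {e : ι → Γ(M, U)} (he : IsBasisOn e) (z : ι → Γ(N, U))
    {V W : X.Opens} (i : V ⟶ U) (j : W ⟶ V) (s : Γ(M, V)) :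
    he.liftApp z (j ≫ i) (M.presheaf.map j.op s) = N.presheaf.map j.op (he.liftApp z i s) := by
  obtain ⟨a, rfl⟩ := (he V i).2 s
  dsimp only
  rw [sum_smul_res, liftApp_sum, liftApp_sum, sum_smul_res]

theorem restrict_smul (W : U.toScheme.Opens) (a : Γ(U, W)) (s : Γ(M.restrict U.ι, W)) :
    a • s = ((show Γ(X, U.ι ''ᵁ W) from a) • (show Γ(M, U.ι ''ᵁ W) from s) :
      Γ(M, U.ι ''ᵁ W)) := by
  refine (smul_restrictAppIso_hom_apply U.ι M W a s).trans ?_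
  rw [Scheme.Opens.ι_appIso]
  rfl

/-- The image in `X` of an open subset of `U` lies in `U`. -/
def imageHom (W : U.toScheme.Opens) : U.ι ''ᵁ W ⟶ U :=
  homOfLE (by rintro _ ⟨y, -, rfl⟩; exact y.2)

/-- The morphism over `U` sending a basis to given sections. -/
def IsBasisOn.lift {e : ι → Γ(M, U)} (he : IsBasisOn e) (z : ι → Γ(N, U)) :
    M.restrict U.ι ⟶ N.restrict U.ι :=
  modulesHomMk (M := M.restrict U.ι) (N := N.restrict U.ι)
    (fun W => (he.liftApp z (imageHom W)).toAddMonoidHom)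
    (fun W r s => by
      rw [restrict_smul, restrict_smul]
      exact (he.liftApp z (imageHom W)).map_smul _ _)
    (fun {W W'} i s => he.liftApp_res z (imageHom W) (U.ι.opensFunctor.map i) s)

theorem IsBasisOn.lift_app {e : ι → Γ(M, U)} (he : IsBasisOn e) (z : ι → Γ(N, U))
    (W : U.toScheme.Opens) (j : ι) :
    (he.lift z).app W (show Γ(M, U.ι ''ᵁ W) from M.presheaf.map (imageHom W).op (e j)) =
    (show Γ(N, U.ι ''ᵁ W) from N.presheaf.map (imageHom W).op (z j)) :=
  he.liftApp_apply z (imageHom W) j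

theorem IsBasisOn.restrict_hom_ext {e : ι → Γ(M, U)} (he : IsBasisOn e)
    {K : U.toScheme.Modules} {g g' : M.restrict U.ι ⟶ K}
    (h : ∀ (W : U.toScheme.Opens) (j : ι),
      g.app W (show Γ(M, U.ι ''ᵁ W) from M.presheaf.map (imageHom W).op (e j)) =
      g'.app W (show Γ(M, U.ι ''ᵁ W) from M.presheaf.map (imageHom W).op (e j))) : g = g' := by
  refine modules_hom_ext _ _ fun W s => ?_
  obtain ⟨a, ha⟩ := (he _ (imageHom W)).2 s
  have hs : s = ∑ j, (show Γ(U, W) from a j) •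
      (show Γ(M.restrict U.ι, W) from M.presheaf.map (imageHom W).op (e j)) := by
    refine ha.symm.trans (Finset.sum_congr rfl fun j _ => ?_)
    exact (restrict_smul W _ _).symm
  rw [hs, map_sum, map_sum]
  refine Finset.sum_congr rfl fun j _ => ?_
  rw [Scheme.Modules.Hom.app_smul, Scheme.Modules.Hom.app_smul]
  exact congrArg _ (h W j)

end Restrict

/-! ### Frobenius pullback of a module with a basis. -/

section Frobenius
open Scheme.Modules

variable {p : ℕ} [Fact p.Prime] {k : Type u} [CommRing k] [CharP k p]
  {X : Scheme.{u}} (f : X ⟶ Spec (.of k)) {M N : X.Modules} {ι : Type} [Fintype ι] {U : X.Opens}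

variable (M) in
/-- The map `M ⟶ F_* F^* M` for the absolute Frobenius `F`. -/
def frobeniusUnit : M ⟶
    (pushforward (schemeFrobenius p f)).obj ((pullback (schemeFrobenius p f)).obj M) :=
  (pullbackPushforwardAdjunction (schemeFrobenius p f)).unit.app M

variable (M) in
/-- The Frobenius pullback of a section. -/
def frobeniusPullback (V : X.Opens) : Γ(M, V) →+ Γ((pullback (schemeFrobenius p f)).obj M, V) :=
  ((frobeniusUnit f M).app V).hom

theorem frobeniusPullback_smul (V : X.Opens) (a : Γ(X, V)) (s : Γ(M, V)) :
    frobeniusPullback f M V (a • s) = a ^ p • frobeniusPullback f M V s :=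
  Scheme.Modules.Hom.app_smul (frobeniusUnit f M) a s

theorem frobeniusPullback_res {V W : X.Opens} (i : W ⟶ V) (s : Γ(M, V)) :
    frobeniusPullback f M W (M.presheaf.map i.op s) =
      ((pullback (schemeFrobenius p f)).obj M).presheaf.map i.op (frobeniusPullback f M V s) :=
  app_res (frobeniusUnit f M) i s

/-- Sections of the pullback are not explicit. The restriction and pullback adjunctions turn such
maps into maps out of `M`, which can be compared on the basis. -/
theorem IsBasisOn.restrict_pullback_hom_ext {e : ι → Γ(M, U)} (he : IsBasisOn e)
    {K : U.toScheme.Modules}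
    {g g' : ((pullback (schemeFrobenius p f)).obj M).restrict U.ι ⟶ K}
    (h : ∀ (W : U.toScheme.Opens) (j : ι),
      g.app W (show Γ((pullback (schemeFrobenius p f)).obj M, U.ι ''ᵁ W) from
        ((pullback (schemeFrobenius p f)).obj M).presheaf.map (imageHom W).op
          (frobeniusPullback f M U (e j))) =
      g'.app W (show Γ((pullback (schemeFrobenius p f)).obj M, U.ι ''ᵁ W) from
        ((pullback (schemeFrobenius p f)).obj M).presheaf.map (imageHom W).op
          (frobeniusPullback f M U (e j)))) :
    g = g' := by
  apply ((restrictAdjunction U.ι).homEquiv _ _).injective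
  apply ((pullbackPushforwardAdjunction (schemeFrobenius p f)).homEquiv _ _).injective
  refine modules_hom_ext _ _ fun V s => ?_
  let W : U.toScheme.Opens := U.ι ⁻¹ᵁ V
  let i : U.ι ''ᵁ W ⟶ V := homOfLE (U.ι.image_preimage_le V)
  suffices hs : g.app W (show Γ((pullback (schemeFrobenius p f)).obj M, U.ι ''ᵁ W) from
      ((pullback (schemeFrobenius p f)).obj M).presheaf.map i.op (frobeniusPullback f M V s)) =
      g'.app W (show Γ((pullback (schemeFrobenius p f)).obj M, U.ι ''ᵁ W) from
      ((pullback (schemeFrobenius p f)).obj M).presheaf.map i.op (frobeniusPullback f M V s)) by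
    rw [Adjunction.homEquiv_unit, Adjunction.homEquiv_unit, Adjunction.homEquiv_unit,
      Adjunction.homEquiv_unit]
    exact hs
  obtain ⟨a, ha⟩ := (he _ (imageHom W)).2 (M.presheaf.map i.op s)
  have key : ((pullback (schemeFrobenius p f)).obj M).presheaf.map i.op (frobeniusPullback f M V s)
      = ∑ j, (show Γ(U, W) from (a j ^ p : Γ(X, U.ι ''ᵁ W))) •
        (show Γ(((pullback (schemeFrobenius p f)).obj M).restrict U.ι, W) from
          ((pullback (schemeFrobenius p f)).obj M).presheaf.map (imageHom W).op
            (frobeniusPullback f M U (e j))) := by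
    rw [← frobeniusPullback_res, ← ha]
    refine (map_sum _ _ _).trans (Finset.sum_congr rfl fun j _ => ?_)
    refine Eq.trans ?_ (restrict_smul W _ _).symm
    rw [frobeniusPullback_smul, frobeniusPullback_res]
  rw [key, map_sum, map_sum]
  refine Finset.sum_congr rfl fun j _ => ?_
  rw [Scheme.Modules.Hom.app_smul, Scheme.Modules.Hom.app_smul]
  exact congrArg _ (h W j)

/-- The inverse sends the basis `y j` back to the pullback of `e j`. Both composites are identities
by extensionality on generators, so freeness of the pullback need not be proved. -/
theorem isIso_restrict_of_isBasisOn (φ : (pullback (schemeFrobenius p f)).obj M ⟶ N)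
    {e : ι → Γ(M, U)} (he : IsBasisOn e) {y : ι → Γ(N, U)} (hy : IsBasisOn y)
    (h : ∀ j, ((pullbackPushforwardAdjunction (schemeFrobenius p f)).homEquiv _ _ φ).app U (e j) =
      y j) : IsIso ((restrictFunctor U.ι).map φ) := by
  let η := frobeniusPullback f M
  have h' : ∀ j, φ.app U (η U (e j)) = y j := fun j => by
    rw [← h, Adjunction.homEquiv_unit]; rfl
  have hres : ∀ (W : U.toScheme.Opens) j, ((restrictFunctor U.ι).map φ).app W
      (show Γ((pullback (schemeFrobenius p f)).obj M, U.ι ''ᵁ W) from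
        ((pullback (schemeFrobenius p f)).obj M).presheaf.map (imageHom W).op (η U (e j))) =
      (show Γ(N, U.ι ''ᵁ W) from N.presheaf.map (imageHom W).op (y j)) := fun W j => by
    rw [← h']
    exact app_res φ (imageHom W) (η U (e j))
  let χ := hy.lift (N := (pullback (schemeFrobenius p f)).obj M) fun j => η U (e j)
  have hχ := hy.lift_app (N := (pullback (schemeFrobenius p f)).obj M) fun j => η U (e j)
  refine ⟨χ, he.restrict_pullback_hom_ext f fun W j => ?_, hy.restrict_hom_ext fun W j => ?_⟩
  · exact (congrArg (χ.app W) (hres W j)).trans (hχ W j)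
  · exact (congrArg (((restrictFunctor U.ι).map φ).app W) (hχ W j)).trans (hres W j)

end Frobenius

/-! ### From the determinant to generic bijectivity. -/

section Generic
open Scheme.Modules

variable {p : ℕ} [Fact p.Prime] {k : Type u} [Field k] [CharP k p]
  {X : Scheme.{u}} (f : X ⟶ Spec (.of k))

include f in
theorem charP_section [IsIntegral X] (U : X.Opens) [Nonempty U] : CharP Γ(X, U) p := by
  let c : k →+* Γ(X, U) := ((constToStructure f).app (op U)).hom
  exact charP_of_injective_ringHom c.injective p

theorem genericallyBijective_of_apply_d [IsIntegral X]
    (φ : (pullback (schemeFrobenius p f)).obj (sheafDifferentials f) ⟶ sheafDifferentials f)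
    {U : X.Opens} (hU : IsAffineOpen U) [Nonempty U] {ι : Type} [Fintype ι]
    (b : Module.Basis ι Γ(X, U) (sectionDifferentials f U)) (x : ι → Γ(X, U))
    (hb : ∀ i, b i = dSec f U (x i)) (δ : ι → Γ(X, U))
    (hδ : ∀ i, ((pullbackPushforwardAdjunction (schemeFrobenius p f)).homEquiv _ _ φ).app U
      (d f U (x i)) = (x i ^ (p - 1) • d f U (x i) + d f U (δ i) : Γ(sheafDifferentials f, U))) :
    GenericallyBijective φ := by
  classical
  let A : Matrix ι ι Γ(X, U) := Matrix.of fun i j =>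
    (if i = j then x i ^ (p - 1) else 0) + b.repr (dSec f U (δ i)) j
  have hdet : A.det ≠ 0 := by
    let : Algebra k Γ(X, U) := ((constToStructure f).app (op U)).hom.toAlgebra
    have : CharP Γ(X, U) p := charP_section f U
    exact det_divided_frobenius_ne_zero (show Module.Basis ι Γ(X, U) Ω[Γ(X, U)⁄k] from b) x hb p δ
  have he := isBasisOn_d f hU b x hb
  have hA : ∀ i, (x i ^ (p - 1) • d f U (x i) + d f U (δ i) : Γ(sheafDifferentials f, U)) =
      ∑ j, A i j • d f U (x j) := by
    intro i
    have h1 : d f U (δ i) = ∑ j, b.repr (dSec f U (δ i)) j • d f U (x j) := by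
      rw [← toSections_d]
      conv_lhs => rw [← b.sum_repr (dSec f U (δ i)), map_sum]
      refine Finset.sum_congr rfl fun j _ => ?_
      rw [toSections_smul, hb]
      rfl
    simp only [A, Matrix.of_apply, add_smul, Finset.sum_add_distrib, ite_smul, zero_smul,
      Finset.sum_ite_eq, Finset.mem_univ, if_true]
    rw [← h1]
  -- The locus where `det A` is invertible: nonempty because the determinant is nonzero, hence dense
  -- because `X` is integral.
  let i : X.basicOpen A.det ⟶ U := homOfLE (X.basicOpen_le _)
  refine ⟨X.basicOpen A.det, (X.basicOpen A.det).2.dense ?_, ?_⟩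
  · refine Opens.nonempty_coe.2 <| (Opens.ne_bot_iff_nonempty _).1 fun h0 => hdet ?_
    exact (basicOpen_eq_bot_iff _).1 h0
  refine isIso_restrict_of_isBasisOn f φ (he.res i)
    (y := fun j => (sheafDifferentials f).presheaf.map i.op
      (x j ^ (p - 1) • d f U (x j) + d f U (δ j))) ?_ ?_
  · refine (he.res i).of_isUnit_det ((X.presheaf.map i.op).hom.mapMatrix A) ?_ fun j => ?_
    · rw [← RingHom.map_det]
      exact X.toRingedSpace.isUnit_res_basicOpen _
    · rw [hA, map_sum]
      exact Finset.sum_congr rfl fun l _ => Scheme.Modules.map_smul _ _ _ _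
  · intro j
    rw [app_res, hδ]
    rfl

end Generic

/-! ### The explicit formula for `φ` and the conclusion. -/

namespace FrobeniusLifting

open Scheme.Modules

variable {p : ℕ} [Fact p.Prime] {k : Type u} [Field k] [IsAlgClosed k] [CharP k p]
  {X : Scheme.{u}} {f : X ⟶ Spec (.of k)} (L : FrobeniusLifting p f)

theorem exists_affine_basis_differentials [IsIntegral X] [Smooth f] :
    ∃ V : L.total.Opens, IsAffineOpen V ∧ Nonempty (L.incl ⁻¹ᵁ V) ∧
      ∃ (ι : Type) (_ : Fintype ι)
        (b : Module.Basis ι Γ(X, L.incl ⁻¹ᵁ V) (sectionDifferentials f (L.incl ⁻¹ᵁ V)))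
        (x : ι → Γ(X, L.incl ⁻¹ᵁ V)), ∀ i, b i = dSec f _ (x i) := by
  obtain ⟨z⟩ : Nonempty X := inferInstance
  obtain ⟨V, hV, hz, -⟩ := exists_isAffineOpen_mem_and_subset (U := ⊤) (x := L.incl z) trivial
  have hU := hV.preimage L.incl
  have : Nonempty (L.incl ⁻¹ᵁ V) := ⟨⟨z, hz⟩⟩
  obtain ⟨g, hg, h⟩ := exists_basis_kaehler_of_smooth _ (constToStructure_smooth f hU)
  -- Lifting `g` makes the coordinate neighbourhood the preimage of an affine open of the lift,
  -- where `F a = a ^ p + p b` is available.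
  obtain ⟨g', rfl⟩ := L.incl_app_surjective hV g
  have hpre := L.incl.preimage_basicOpen g'
  refine ⟨L.total.basicOpen g', hV.basicOpen g', ?_, ?_⟩
  · rw [hpre]
    by_contra hne
    exact hg <| (basicOpen_eq_bot_iff _).1 <| (Opens.not_nonempty_iff_eq_bot _).1 fun ⟨y, hy⟩ => hne ⟨⟨y, hy⟩⟩
  · rw [hpre]
    refine h _ (X.presheaf.map (homOfLE (X.basicOpen_le _)).op) _ ?_
      (hU.isLocalization_basicOpen _)
    exact ((constToStructure f).naturality (homOfLE (X.basicOpen_le _)).op).symm.trans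
      (Category.id_comp _)

variable {L}
variable {P : (pushforward L.incl).obj (sheafDifferentials f) ⟶ sheafDifferentials L.str}

/-- The explicit formula `φ (F_X^* dx) = x ^ (p - 1) dx + dδ`. -/
theorem IsMulP.exists_isDivided_d [Smooth f] (hP : L.IsMulP P) (h : L.IsSemilinear) {φ : _ ⟶ _}
    (hφ : L.IsDivided h P φ) {V : L.total.Opens} (hV : IsAffineOpen V)
    (x : Γ(X, L.incl ⁻¹ᵁ V)) : ∃ δ : Γ(X, L.incl ⁻¹ᵁ V),
      ((pullbackPushforwardAdjunction (schemeFrobenius p f)).homEquiv _ _ φ).app (L.incl ⁻¹ᵁ V)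
        (d f _ x) = (x ^ (p - 1) • d f _ x + d f _ δ : Γ(sheafDifferentials f, L.incl ⁻¹ᵁ V)) := by
  have := hP.mono
  obtain ⟨a, rfl⟩ := L.incl_app_surjective hV x
  obtain ⟨b, hb⟩ := L.exists_F_app_eq hV a
  set ψ := (pullbackPushforwardAdjunction (schemeFrobenius p f)).homEquiv _ _ φ with hψ
  have h1 := hP.dF_d h a _ b hb
  rw [hφ] at h1
  have h2 : (sheafDifferentials f).presheaf.map (homOfLE (L.incl_preimage_F V).le).op
      (ψ.app (L.incl ⁻¹ᵁ V) (d f _ (L.incl.app V a))) = L.reduction.app (L.F ⁻¹ᵁ V)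
        ((L.total.presheaf.map (homOfLE (L.preimage_F V).le).op a) ^ (p - 1) •
          d L.str _ (L.total.presheaf.map (homOfLE (L.preimage_F V).le).op a) + d L.str _ b) := by
    refine app_injective_of_mono P (L.F ⁻¹ᵁ V) (Eq.trans ?_ h1)
    rw [← reduction_d]
    exact congrArg (P.app (L.F ⁻¹ᵁ V)) (L.pushforwardSquare_hom_app _ V _).symm
  -- `δ` is the reduction of `b`, where `p b = F a - a ^ p`, carried back along `F⁻¹ V = V`.
  refine ⟨X.presheaf.map (homOfLE (L.incl_preimage_F V).ge).op (L.incl.app _ b), ?_⟩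
  have h3 := congrArg ((sheafDifferentials f).presheaf.map
    (homOfLE (L.incl_preimage_F V).ge).op) h2
  have h4 : L.reduction.app (L.F ⁻¹ᵁ V)
      ((L.total.presheaf.map (homOfLE (L.preimage_F V).le).op a) ^ (p - 1) •
        d L.str _ (L.total.presheaf.map (homOfLE (L.preimage_F V).le).op a) + d L.str _ b) =
      ((X.presheaf.map (homOfLE (L.incl_preimage_F V).le).op (L.incl.app V a)) ^ (p - 1) •
        d f _ (X.presheaf.map (homOfLE (L.incl_preimage_F V).le).op (L.incl.app V a)) +
        d f _ (L.incl.app _ b) : Γ(sheafDifferentials f, L.incl ⁻¹ᵁ (L.F ⁻¹ᵁ V))) := by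
    rw [map_add, Scheme.Modules.Hom.app_smul, reduction_d, reduction_d]
    refine congrArg (· + d f _ (L.incl.app _ b))
      ((pushforward_smul (M := sheafDifferentials f) L.incl _ _ _).trans ?_)
    rw [map_pow, incl_app_res]
    rfl
  have hid : ∀ s : Γ(sheafDifferentials f, L.incl ⁻¹ᵁ V),
      (sheafDifferentials f).presheaf.map (homOfLE (L.incl_preimage_F V).ge).op
        ((sheafDifferentials f).presheaf.map (homOfLE (L.incl_preimage_F V).le).op s) = s := by
    intro s
    rw [res_res]
    exact ConcreteCategory.congr_hom ((sheafDifferentials f).presheaf.map_id _) s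
  refine (hid _).symm.trans (h3.trans ?_)
  rw [h4, map_add, Scheme.Modules.map_smul, d_res, d_res, map_pow, structure_res_res]
  have hid' : X.presheaf.map (homOfLE (L.incl_preimage_F V).ge ≫
      homOfLE (L.incl_preimage_F V).le).op (L.incl.app V a) = L.incl.app V a :=
    ConcreteCategory.congr_hom (X.presheaf.map_id _) _
  rw [hid']

theorem IsMulP.genericallyBijective [IsIntegral X] [Smooth f] (hP : L.IsMulP P)
    (h : L.IsSemilinear) {φ : _ ⟶ _} (hφ : L.IsDivided h P φ) : GenericallyBijective φ := by
  obtain ⟨V, hV, hne, ι, _, b, x, hb⟩ := L.exists_affine_basis_differentials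
  choose δ hδ using fun i => hP.exists_isDivided_d h hφ hV (x i)
  exact genericallyBijective_of_apply_d f φ (hV.preimage L.incl) b x hb δ hδ

end FrobeniusLifting

end FrobLift

end

theorem mainTheorem2 (p : ℕ) [Fact p.Prime] {k : Type u} [Field k] [IsAlgClosed k] [CharP k p]
    {X : Scheme.{u}} (f : X ⟶ Spec (.of k))
    [IsIntegral X] [IsSeparated f] [QuasiCompact f] [Smooth f]
    (L : FrobLift.FrobeniusLifting p f) :
    ∃ h : L.IsSemilinear,
      ∃ P : (Scheme.Modules.pushforward L.incl).obj (FrobLift.sheafDifferentials f) ⟶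
          FrobLift.sheafDifferentials L.str,
        L.IsMulP P ∧ (∀ P', L.IsMulP P' → P' = P) ∧ Mono P ∧
        ∃ φ : (Scheme.Modules.pullback (FrobLift.schemeFrobenius p f)).obj
              (FrobLift.sheafDifferentials f) ⟶ FrobLift.sheafDifferentials f,
          L.IsDivided h P φ ∧ (∀ φ', L.IsDivided h P φ' → φ' = φ) ∧
          FrobLift.GenericallyBijective φ := by
  obtain ⟨P, hP⟩ := L.exists_isMulP
  obtain ⟨φ, hφ⟩ := hP.exists_isDivided L.isSemilinear
  exact ⟨L.isSemilinear, P, hP, hP.unique, hP.mono, φ, hφ,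
    fun _ hφ' => hP.isDivided_unique _ hφ hφ', hP.genericallyBijective _ hφ⟩
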